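/- Let $d\ge 1$ be an integer and let $d\gamma=(2\pi)^{-d/2}e^{-|x|^2/2}\,dx$ be the normalized Gaussian probability measure on $\mathbb R^d$. Let $\|\cdot\|_2$ denote the norm of $\mathrm L^2(\mathbb R^d,d\gamma)$ (for scalar or $\mathbb R^d$-valued functions), and let $\mathrm H^1(\mathbb R^d,d\gamma)$ be the space of real-valued functions $u\in\mathrm L^2(\mathbb R^d,d\gamma)$ whose weak gradient $\nabla u$ is in $\mathrm L^2(\mathbb R^d,d\gamma)$. Let $u\in\mathrm H^1(\mathbb R^d,d\gamma)$ be such that $\|u\|_2=1$ and $\|x\,u\|_2^2\le d$. Then $|u|^2\log|u|^2$ (with $0\log 0=0$) is integrable with respect to $d\gamma$, $$\|\nabla u\|_2^2-\frac12\int_{\mathbb R^d}|u|^2\log|u|^2\,d\gamma\;\ge\;\frac1{2d}\left(\int_{\mathbb R^d}|u|^2\log|u|^2\,d\gamma\right)^2,$$ and, with $\psi(s):=s-\frac d4\log\left(1+\frac4d\,s\right)$, we also have the estimate $$\|\nabla u\|_2^2-\frac12\int_{\mathbb R^d}|u|^2\log|u|^2\,d\gamma\;\ge\;\psi\left(\|\nabla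 u\|_2^2\right),$$ which is stronger in the sense that $\psi\left(\|\nabla u\|_2^2\right)\ge\frac1{2d}\left(\int_{\mathbb R^d}|u|^2\log|u|^2\,d\gamma\right)^2$. -/

import Mathlib

open MeasureTheory
open scoped ContDiff

namespace GaussianLSI

/-- The density `γ(x) = (2π)^(-d/2) exp(-|x|²/2)` on `ℝ^d`. -/
noncomputable def gaussianDensity (d : ℕ) (x : EuclideanSpace ℝ (Fin d)) : ℝ :=
  (2 * Real.pi) ^ (-(d : ℝ) / 2) * Real.exp (-(1 / 2) * ‖x‖ ^ 2)

/-- The Gaussian measure `dγ = γ(x) dx` on `ℝ^d`. -/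
noncomputable def gaussian (d : ℕ) : Measure (EuclideanSpace ℝ (Fin d)) :=
  volume.withDensity fun x => ENNReal.ofReal (gaussianDensity d x)

/-- `G` is the weak (distributional) gradient of `u` on `ℝ^d`: both are locally integrable, and
`∫ u ∂_v φ dx = - ∫ φ (G · v) dx` for every test function `φ ∈ C_c^∞(ℝ^d)` and every direction
`v`. -/
structure HasWeakGradient {d : ℕ} (u : EuclideanSpace ℝ (Fin d) → ℝ)
    (G : EuclideanSpace ℝ (Fin d) → EuclideanSpace ℝ (Fin d)) : Prop where
  locallyIntegrable : LocallyIntegrable u volume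
  locallyIntegrable_gradient : LocallyIntegrable G volume
  integral_eq : ∀ φ : EuclideanSpace ℝ (Fin d) → ℝ, ContDiff ℝ ∞ φ → HasCompactSupport φ →
    ∀ v : EuclideanSpace ℝ (Fin d),
      ∫ x, u x * fderiv ℝ φ x v = - ∫ x, φ x * inner ℝ (G x) v

/-- `u ∈ H¹(ℝ^d, dγ)`: `u` is in `L²(dγ)` and has a weak gradient in `L²(dγ)`. -/
def MemH1 {d : ℕ} (u : EuclideanSpace ℝ (Fin d) → ℝ) : Prop :=
  MemLp u 2 (gaussian d) ∧
    ∃ G : EuclideanSpace ℝ (Fin d) → EuclideanSpace ℝ (Fin d),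
      HasWeakGradient u G ∧ MemLp G 2 (gaussian d)

/-- The entropy `∫ |u|² log |u|² dγ`. -/
noncomputable def entropy {d : ℕ} (u : EuclideanSpace ℝ (Fin d) → ℝ) : ℝ :=
  ∫ x, |u x| ^ 2 * Real.log (|u x| ^ 2) ∂(gaussian d)

/-- `‖G‖²` in `L²(dγ)`, for a vector field `G`; used with `G = ∇u`. -/
noncomputable def normSq {d : ℕ}
    (G : EuclideanSpace ℝ (Fin d) → EuclideanSpace ℝ (Fin d)) : ℝ :=
  ∫ x, ‖G x‖ ^ 2 ∂(gaussian d)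

/-- `ψ(s) = s - (d/4) log (1 + (4/d) s)`. -/
noncomputable def psi (d : ℕ) (s : ℝ) : ℝ :=
  s - (d : ℝ) / 4 * Real.log (1 + 4 / (d : ℝ) * s)

end GaussianLSI

/-!
The estimate is the scale-invariant form of the Gaussian logarithmic Sobolev inequality.

For a `C¹` density `f`, bounded above and below and with bounded gradient, consider the Mehler
averages `x ↦ ∫ h (cos θ x + sin θ y) dγ(y)`, written `h_θ`. They join `f` (at `θ = 0`) to the
constant `∫ f dγ` (at `θ = π / 2`). Rotation invariance of `γ ⊗ γ` and one Gaussian integration by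
parts show that `∫ f_θ log f_θ dγ` has the derivative `- sin θ cos θ ∫ ‖(∇f)_θ‖² / f_θ dγ`, and by
Cauchy–Schwarz the last integral is at most `∫ ‖∇f‖² / f dγ`. Integrating over `[0, π / 2]` gives
`∫ f log f dγ - (∫ f dγ) log (∫ f dγ) ≤ ½ ∫ ‖∇f‖² / f dγ` (`IsRegular.integral_mul_log_le`). With
`f = u² + ε` and `ε → 0` the right-hand side becomes `2 ∫ ‖∇u‖² dγ`, for `u` in `C¹` with compact
support (`IsC1c.integral_sq_mul_log_le`).

Applied to `x ↦ u (σ x) exp ((1 - σ²) ‖x‖² / 4)` with `σ² = τ`, this becomes, with `m = ∫ u² dγ`,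
`M = ∫ ‖x‖² u² dγ` and `I = ∫ ‖∇u‖² dγ`, the family of inequalities
`∫ u² log u² dγ ≤ m log m + 2 τ I + (1 - τ) M / 2 - d (1 - τ) m - (d / 2) m log τ`
(`IsC1c.integral_sq_mul_log_le_lsiBound`). Its right-hand side does not decrease in `M` and `I` when
`0 < τ ≤ 1`, and `t log t ≥ -1`, so Fatou's lemma carries it over to limits
(`satisfiesLSI_of_tendsto`). Cutting off and mollifying, it extends to all of `H¹(γ)` with finite
second moment (`HasWeakGradient.satisfiesLSI`).

For `m = 1` and `M ≤ d` the choice `τ = 1 / (1 + 4 I / d)` yields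
`∫ u² log u² dγ ≤ (d / 2) log (1 + 4 I / d)`, which is the estimate with `ψ`. As the entropy is
nonnegative, the bound `exp L ≥ 1 + L + L² / 2` at `L = log (1 + 4 I / d)` compares `ψ(I)` with the
square of the entropy.
-/

namespace GaussianLSI

open ProbabilityTheory Filter Topology

variable {d : ℕ}

local notation "𝔼" => EuclideanSpace ℝ (Fin d)

/-! ### The Gaussian measure -/

lemma gaussianDensity_pos (x : 𝔼) : 0 < gaussianDensity d x := by
  unfold gaussianDensity; positivity

lemma contDiff_gaussianDensity : ContDiff ℝ ∞ (gaussianDensity d) := by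
  unfold gaussianDensity
  exact contDiff_const.mul ((contDiff_const.mul (contDiff_norm_sq ℝ)).exp)

lemma continuous_gaussianDensity : Continuous (gaussianDensity d) :=
  contDiff_gaussianDensity.continuous

lemma integral_gaussian {F : Type*} [NormedAddCommGroup F] [NormedSpace ℝ F] (g : 𝔼 → F) :
    ∫ x, g x ∂(gaussian d) = ∫ x, gaussianDensity d x • g x := by
  unfold gaussian
  rw [integral_withDensity_eq_integral_toReal_smul
    (continuous_gaussianDensity.measurable.ennreal_ofReal) (by simp)]
  simp [ENNReal.toReal_ofReal (gaussianDensity_pos _).le]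

lemma lintegral_gaussian (g : 𝔼 → ENNReal) :
    ∫⁻ x, g x ∂(gaussian d) = ∫⁻ x, ENNReal.ofReal (gaussianDensity d x) * g x := by
  unfold gaussian
  rw [lintegral_withDensity_eq_lintegral_mul_non_measurable]
  · rfl
  · exact continuous_gaussianDensity.measurable.ennreal_ofReal
  · simp

lemma integrable_gaussian_iff {F : Type*} [NormedAddCommGroup F] [NormedSpace ℝ F] {g : 𝔼 → F} :
    Integrable g (gaussian d) ↔ Integrable (fun x => gaussianDensity d x • g x) := by
  unfold gaussian
  rw [integrable_withDensity_iff_integrable_smul'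
    (continuous_gaussianDensity.measurable.ennreal_ofReal) (by simp)]
  simp [ENNReal.toReal_ofReal (gaussianDensity_pos _).le]

lemma gaussian_ac : gaussian d ≪ volume := withDensity_absolutelyContinuous _ _

/-- The total mass is read off from the Gaussian integral. -/
lemma integral_gaussianDensity : ∫ x : 𝔼, gaussianDensity d x = 1 := by
  unfold gaussianDensity
  rw [integral_const_mul]
  have := GaussianFourier.integral_rexp_neg_mul_sq_norm (V := 𝔼) (b := 1 / 2) (by norm_num)
  rw [this]
  rw [show Real.pi / (1 / 2) = 2 * Real.pi by ring, finrank_euclideanSpace, Fintype.card_fin,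
    ← Real.rpow_add (by positivity), neg_div, neg_add_cancel, Real.rpow_zero]

lemma integrable_gaussianDensity : Integrable (gaussianDensity d) := by
  by_contra h
  have := integral_gaussianDensity (d := d)
  rw [integral_undef h] at this
  exact zero_ne_one this

instance isProbabilityMeasure_gaussian : IsProbabilityMeasure (gaussian d) := by
  constructor
  have := lintegral_gaussian (d := d) (fun _ => 1)
  simp only [lintegral_const, one_mul, mul_one] at this
  rw [this, ← ofReal_integral_eq_lintegral_ofReal integrable_gaussianDensity
    (ae_of_all _ fun x => (gaussianDensity_pos x).le), integral_gaussianDensity]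
  simp

/-- The measure given by the Gaussian density is Mathlib's standard Gaussian: the two have the same
characteristic function. -/
lemma gaussian_eq_stdGaussian : gaussian d = stdGaussian 𝔼 := by
  apply Measure.ext_of_charFun
  ext t
  rw [charFun_stdGaussian, charFun_apply, integral_gaussian]
  have h := GaussianFourier.integral_cexp_neg_mul_sq_norm_add (V := 𝔼) (b := 1 / 2) (by norm_num)
    Complex.I t
  have h0 : ∀ x : 𝔼, gaussianDensity d x • Complex.exp (inner ℝ x t * Complex.I)
      = (((2 * Real.pi) ^ (-(d : ℝ) / 2) : ℝ) : ℂ) *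
        Complex.exp (-(1 / 2) * ‖x‖ ^ 2 + Complex.I * inner ℝ t x) := by
    intro x
    rw [Complex.exp_add, real_inner_comm, Complex.real_smul]
    unfold gaussianDensity
    push_cast
    rw [mul_assoc, mul_comm Complex.I]
  simp_rw [h0]
  rw [integral_const_mul, h, finrank_euclideanSpace, Fintype.card_fin, ← mul_assoc]
  have h1 : (((2 * Real.pi) ^ (-(d : ℝ) / 2) : ℝ) : ℂ) * ((Real.pi : ℂ) / (1 / 2)) ^ ((d : ℂ) / 2)
      = 1 := by
    have : ((Real.pi : ℂ) / (1 / 2)) ^ ((d : ℂ) / 2)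
        = (((2 * Real.pi) ^ ((d : ℝ) / 2) : ℝ) : ℂ) := by
      rw [Complex.ofReal_cpow (by positivity)]
      push_cast
      congr 1
      ring
    rw [this, ← Complex.ofReal_mul, ← Real.rpow_add (by positivity)]
    simp [neg_div]
  rw [h1, one_mul]
  congr 1
  rw [Complex.I_sq]
  ring

instance isGaussian_gaussian : IsGaussian (gaussian d) := by
  rw [gaussian_eq_stdGaussian]; infer_instance

/-- The product `γ ⊗ γ` is invariant under the rotations mixing the two factors. -/
lemma measurePreserving_rotation (θ : ℝ) :
    MeasurePreserving (ContinuousLinearMap.rotation (E := 𝔼) θ)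
      ((gaussian d).prod (gaussian d)) ((gaussian d).prod (gaussian d)) := by
  refine ⟨(ContinuousLinearMap.continuous _).measurable, ?_⟩
  refine IsGaussian.map_rotation_eq_self ?_ θ
  rw [gaussian_eq_stdGaussian]
  exact integral_id_stdGaussian

lemma memLp_id_gaussian (p : ENNReal) (hp : p ≠ ⊤) :
    MemLp (fun x : 𝔼 => x) p (gaussian d) := IsGaussian.memLp_id _ _ hp

lemma integrable_norm_gaussian : Integrable (fun x : 𝔼 => ‖x‖) (gaussian d) :=
  ((memLp_id_gaussian (d := d) 1 (by simp)).integrable le_rfl).norm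

lemma hasFDerivAt_gaussianDensity (x : 𝔼) :
    HasFDerivAt (gaussianDensity d) (-(gaussianDensity d x) • innerSL ℝ x) x := by
  unfold gaussianDensity
  have h := (((hasStrictFDerivAt_norm_sq x).hasFDerivAt.const_mul (-(1 / 2 : ℝ))).exp).const_mul
    ((2 * Real.pi) ^ (-(d : ℝ) / 2))
  refine h.congr_fderiv ?_
  ext v
  simp
  ring

/-- Gaussian integration by parts: `w - ⟨w, ·⟩` is the adjoint of the derivative along `w`. -/
lemma integral_mul_inner_gaussian {h : 𝔼 → ℝ} (w : 𝔼) (hd : Differentiable ℝ h)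
    (h1 : Integrable h (gaussian d)) (h2 : Integrable (fun x => fderiv ℝ h x w) (gaussian d))
    (h3 : Integrable (fun x => h x * inner ℝ w x) (gaussian d)) :
    ∫ x, h x * inner ℝ w x ∂(gaussian d) = ∫ x, fderiv ℝ h x w ∂(gaussian d) := by
  rw [integrable_gaussian_iff] at h1 h2 h3
  have hf : ∀ x : 𝔼, fderiv ℝ (gaussianDensity d) x w = -(gaussianDensity d x * inner ℝ w x) := by
    intro x
    rw [(hasFDerivAt_gaussianDensity x).fderiv, real_inner_comm]
    simp
  have := integral_mul_fderiv_eq_neg_fderiv_mul_of_integrable (μ := (volume : Measure 𝔼))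
    (f := gaussianDensity d) (g := h) (v := w) ?_ ?_ ?_
    (fun x _ => (hasFDerivAt_gaussianDensity x).differentiableAt) (fun x _ => hd x)
  · rw [integral_gaussian, integral_gaussian]
    simp only [smul_eq_mul]
    rw [this, ← integral_neg]
    congr 1
    ext x
    rw [hf]
    ring
  · refine h3.neg.congr (ae_of_all _ fun x => ?_)
    simp only [hf, Pi.neg_apply, smul_eq_mul]
    ring
  · simpa using h2
  · simpa using h1

/-! ### Mehler averages and the inequality for regular densities -/

/-- The Mehler average `x ↦ ∫ h (cos θ x + sin θ y) dγ(y)`: the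
Ornstein–Uhlenbeck semigroup at time `t`, in the parametrization `exp (-t) = cos θ`. -/
noncomputable def mehler {F : Type*} [NormedAddCommGroup F] [NormedSpace ℝ F] (h : 𝔼 → F) (θ : ℝ)
    (x : 𝔼) : F :=
  ∫ y, h (Real.cos θ • x + Real.sin θ • y) ∂(gaussian d)

/-- The derivative of `θ ↦ mehler f θ x`, where `g` is the gradient of `f`. -/
noncomputable def mehlerDeriv (g : 𝔼 → 𝔼) (θ : ℝ) (x : 𝔼) : ℝ :=
  ∫ y, inner ℝ (g (Real.cos θ • x + Real.sin θ • y)) (-Real.sin θ • x + Real.cos θ • y)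
    ∂(gaussian d)

/-- `f` is continuously differentiable with gradient `g`, takes values in `[a, b]` with `0 < a`, and
`g` is bounded by `L`. -/
structure IsRegular (f : 𝔼 → ℝ) (g : 𝔼 → 𝔼) (a b L : ℝ) : Prop where
  hasFDerivAt : ∀ x, HasFDerivAt f (innerSL ℝ (g x)) x
  continuous_gradient : Continuous g
  norm_gradient_le : ∀ x, ‖g x‖ ≤ L
  pos : 0 < a
  le_apply : ∀ x, a ≤ f x
  apply_le : ∀ x, f x ≤ b

lemma continuous_mehler {F : Type*} [NormedAddCommGroup F] [NormedSpace ℝ F] {h : 𝔼 → F} {C : ℝ}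
    (hc : Continuous h) (hb : ∀ x, ‖h x‖ ≤ C) (θ : ℝ) : Continuous (mehler h θ) := by
  refine continuous_of_dominated (bound := fun _ => C) (fun x => ?_)
    (fun x => ae_of_all _ fun y => hb _) (integrable_const _) (ae_of_all _ fun y => ?_)
  · exact (by fun_prop : Continuous _).aestronglyMeasurable
  · fun_prop

lemma integrable_of_continuous_of_bound {α F : Type*} [TopologicalSpace α] [MeasurableSpace α]
    [OpensMeasurableSpace α] [NormedAddCommGroup F] [SecondCountableTopologyEither α F]
    {μ : Measure α} [IsFiniteMeasure μ]
    {h : α → F} {C : ℝ} (hc : Continuous h) (hb : ∀ x, ‖h x‖ ≤ C) : Integrable h μ :=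
  Integrable.of_bound hc.aestronglyMeasurable C (ae_of_all _ hb)

lemma norm_mehler_le {F : Type*} [NormedAddCommGroup F] [NormedSpace ℝ F] {h : 𝔼 → F} {C : ℝ}
    (hb : ∀ x, ‖h x‖ ≤ C) (θ : ℝ) (x : 𝔼) : ‖mehler h θ x‖ ≤ C := by
  have := norm_integral_le_of_norm_le_const (μ := gaussian d)
    (ae_of_all _ fun y => hb (Real.cos θ • x + Real.sin θ • y))
  simpa [mehler] using this

/-- Stationarity of the Gaussian measure under the Mehler averages. -/
lemma integral_mehler {h : 𝔼 → ℝ} {C : ℝ} (hc : Continuous h) (hb : ∀ x, ‖h x‖ ≤ C) (θ : ℝ) :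
    ∫ x, mehler h θ x ∂(gaussian d) = ∫ x, h x ∂(gaussian d) := by
  have h1 := (measurePreserving_rotation (d := d) θ).map_eq
  have h2 : ∫ p : 𝔼 × 𝔼, h p.1 ∂((gaussian d).prod (gaussian d)) = ∫ x, h x ∂(gaussian d) := by
    simpa using integral_fun_fst (μ := gaussian d) (ν := gaussian d) h
  rw [← h2]
  conv_rhs => rw [← h1]
  have h3 : AEStronglyMeasurable (fun p : 𝔼 × 𝔼 => h p.1)
      (Measure.map (ContinuousLinearMap.rotation θ) ((gaussian d).prod (gaussian d))) :=
    (hc.comp continuous_fst).aestronglyMeasurable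
  rw [integral_map (measurePreserving_rotation (d := d) θ).measurable.aemeasurable h3,
    integral_prod]
  · rfl
  · refine integrable_of_continuous_of_bound (C := C) ?_ fun p => hb _
    exact hc.comp (continuous_fst.comp (ContinuousLinearMap.continuous _))

namespace IsRegular

variable {f : EuclideanSpace ℝ (Fin d) → ℝ}
  {g : EuclideanSpace ℝ (Fin d) → EuclideanSpace ℝ (Fin d)} {a b L : ℝ}

lemma continuous (H : IsRegular f g a b L) : Continuous f :=
  continuous_iff_continuousAt.2 fun x => (H.hasFDerivAt x).continuousAt

lemma norm_le (H : IsRegular f g a b L) (x : 𝔼) : ‖f x‖ ≤ b := by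
  rw [Real.norm_of_nonneg (H.pos.le.trans (H.le_apply x))]
  exact H.apply_le x

lemma bound_nonneg (H : IsRegular f g a b L) : 0 ≤ L := (norm_nonneg _).trans (H.norm_gradient_le 0)

lemma integrable_shift (H : IsRegular f g a b L) (θ : ℝ) (x : 𝔼) :
    Integrable (fun y => f (Real.cos θ • x + Real.sin θ • y)) (gaussian d) :=
  integrable_of_continuous_of_bound (H.continuous.comp (by fun_prop)) fun _ => H.norm_le _

lemma integrable_gradient_shift (H : IsRegular f g a b L) (θ : ℝ) (x : 𝔼) :
    Integrable (fun y => g (Real.cos θ • x + Real.sin θ • y)) (gaussian d) :=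
  integrable_of_continuous_of_bound (H.continuous_gradient.comp (by fun_prop))
    fun _ => H.norm_gradient_le _

lemma le_mehler (H : IsRegular f g a b L) (θ : ℝ) (x : 𝔼) : a ≤ mehler f θ x := by
  have := integral_mono (integrable_const a) (H.integrable_shift θ x) fun y => H.le_apply _
  simpa [mehler] using this

lemma mehler_pos (H : IsRegular f g a b L) (θ : ℝ) (x : 𝔼) : 0 < mehler f θ x :=
  H.pos.trans_le (H.le_mehler θ x)

lemma mehler_le (H : IsRegular f g a b L) (θ : ℝ) (x : 𝔼) : mehler f θ x ≤ b := by
  have := integral_mono (H.integrable_shift θ x) (integrable_const b) fun y => H.apply_le _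
  simpa [mehler] using this

lemma continuous_mehler (H : IsRegular f g a b L) (θ : ℝ) : Continuous (mehler f θ) :=
  GaussianLSI.continuous_mehler H.continuous H.norm_le θ

lemma continuous_mehler_gradient (H : IsRegular f g a b L) (θ : ℝ) : Continuous (mehler g θ) :=
  GaussianLSI.continuous_mehler H.continuous_gradient H.norm_gradient_le θ

lemma hasFDerivAt_mehler (H : IsRegular f g a b L) (θ : ℝ) (x : 𝔼) :
    HasFDerivAt (mehler f θ) (Real.cos θ • innerSL ℝ (mehler g θ x)) x := by
  have key := hasFDerivAt_integral_of_dominated_of_fderiv_le (μ := gaussian d) (x₀ := x)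
    (F := fun x y => f (Real.cos θ • x + Real.sin θ • y))
    (F' := fun x y => Real.cos θ • innerSL ℝ (g (Real.cos θ • x + Real.sin θ • y)))
    (bound := fun _ => L) univ_mem
    (Eventually.of_forall fun z => (H.integrable_shift θ z).1) (H.integrable_shift θ x)
    ?_ (ae_of_all _ fun y z _ => ?_) (integrable_const _) (ae_of_all _ fun y z _ => ?_)
  · refine key.congr_fderiv ?_
    rw [integral_smul]
    congr 1
    exact (innerSL ℝ).integral_comp_comm (H.integrable_gradient_shift θ x)
  · have hc : Continuous fun y => g (Real.cos θ • x + Real.sin θ • y) :=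
      H.continuous_gradient.comp (by fun_prop)
    exact (((innerSL ℝ).continuous.comp hc).const_smul (Real.cos θ)).aestronglyMeasurable
  · rw [norm_smul, innerSL_apply_norm]
    calc _ ≤ 1 * L := mul_le_mul (Real.abs_cos_le_one θ) (H.norm_gradient_le _) (norm_nonneg _)
          zero_le_one
      _ = L := one_mul L
  · have h1 : HasFDerivAt (fun z : 𝔼 => Real.cos θ • z + Real.sin θ • y)
        (Real.cos θ • ContinuousLinearMap.id ℝ 𝔼) z :=
      ((hasFDerivAt_id z).const_smul (Real.cos θ)).add_const _
    refine ((H.hasFDerivAt _).comp z h1).congr_fderiv ?_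
    ext v
    simp

lemma norm_integrand_le (H : IsRegular f g a b L) (θ : ℝ) (x y : 𝔼) :
    ‖(inner ℝ (g (Real.cos θ • x + Real.sin θ • y)) (-Real.sin θ • x + Real.cos θ • y) : ℝ)‖
      ≤ L * (‖x‖ + ‖y‖) := by
  refine (norm_inner_le_norm _ _).trans ?_
  refine mul_le_mul (H.norm_gradient_le _) ?_ (norm_nonneg _) H.bound_nonneg
  refine (norm_add_le _ _).trans (add_le_add ?_ ?_)
  · rw [norm_smul, norm_neg]
    exact mul_le_of_le_one_left (norm_nonneg _) (Real.abs_sin_le_one θ)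
  · rw [norm_smul]
    exact mul_le_of_le_one_left (norm_nonneg _) (Real.abs_cos_le_one θ)

lemma hasDerivAt_mehler (H : IsRegular f g a b L) (θ : ℝ) (x : 𝔼) :
    HasDerivAt (fun θ => mehler f θ x) (mehlerDeriv g θ x) θ := by
  refine (hasDerivAt_integral_of_dominated_loc_of_deriv_le (μ := gaussian d) (x₀ := θ)
    (F := fun θ y => f (Real.cos θ • x + Real.sin θ • y))
    (F' := fun θ y => inner ℝ (g (Real.cos θ • x + Real.sin θ • y))
      (-Real.sin θ • x + Real.cos θ • y))
    (bound := fun y => L * (‖x‖ + ‖y‖)) univ_mem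
    (Eventually.of_forall fun z => (H.integrable_shift z x).1) (H.integrable_shift θ x)
    ?_ (ae_of_all _ fun y t _ => H.norm_integrand_le t x y) ?_ (ae_of_all _ fun y t _ => ?_)).2
  · exact (Continuous.inner (H.continuous_gradient.comp (by fun_prop))
      (by fun_prop)).aestronglyMeasurable
  · exact ((integrable_const _).add integrable_norm_gaussian).const_mul L
  · have h1 : HasDerivAt (fun t : ℝ => Real.cos t • x + Real.sin t • y)
        (-Real.sin t • x + Real.cos t • y) t :=
      ((Real.hasDerivAt_cos t).smul_const x).add ((Real.hasDerivAt_sin t).smul_const y)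
    exact (H.hasFDerivAt _).comp_hasDerivAt t h1

lemma norm_mehlerDeriv_le (H : IsRegular f g a b L) (θ : ℝ) (x : 𝔼) :
    ‖mehlerDeriv g θ x‖ ≤ L * (‖x‖ + ∫ y, ‖y‖ ∂(gaussian d)) := by
  have h := norm_integral_le_of_norm_le (μ := gaussian d)
    (((integrable_const ‖x‖).add integrable_norm_gaussian).const_mul L)
    (ae_of_all _ fun y => H.norm_integrand_le θ x y)
  rw [integral_const_mul] at h
  have h2 : ∫ y, (‖x‖ + ‖y‖) ∂(gaussian d) = ‖x‖ + ∫ y, ‖y‖ ∂(gaussian d) := by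
    rw [integral_add (integrable_const _) integrable_norm_gaussian]
    simp
  exact h.trans_eq (congrArg (L * ·) h2)

lemma stronglyMeasurable_mehlerDeriv (H : IsRegular f g a b L) (θ : ℝ) :
    StronglyMeasurable (mehlerDeriv g θ) := by
  refine StronglyMeasurable.integral_prod_right' (f := fun p : 𝔼 × 𝔼 =>
    (inner ℝ (g (Real.cos θ • p.1 + Real.sin θ • p.2)) (-Real.sin θ • p.1 + Real.cos θ • p.2) : ℝ))
    ?_
  exact (Continuous.inner (H.continuous_gradient.comp (by fun_prop))
    (by fun_prop)).stronglyMeasurable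

lemma abs_log_add_one_le (H : IsRegular f g a b L) {t : ℝ} (h1 : a ≤ t) (h2 : t ≤ b) :
    ‖Real.log t + 1‖ ≤ |Real.log a| + |Real.log b| + 1 := by
  have ha := Real.log_le_log H.pos h1
  have hb := Real.log_le_log (H.pos.trans_le h1) h2
  have h3 := neg_abs_le (Real.log a)
  have h4 := le_abs_self (Real.log b)
  have h5 := abs_nonneg (Real.log a)
  have h6 := abs_nonneg (Real.log b)
  rw [Real.norm_eq_abs, abs_le]
  constructor <;> linarith

lemma continuous_log_mehler (H : IsRegular f g a b L) (θ : ℝ) :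
    Continuous fun x => Real.log (mehler f θ x) + 1 :=
  ((H.continuous_mehler θ).log fun x => (H.mehler_pos θ x).ne').add continuous_const

lemma hasDerivAt_integral_mehler_mul_log (H : IsRegular f g a b L) (θ : ℝ) :
    HasDerivAt (fun θ => ∫ x, mehler f θ x * Real.log (mehler f θ x) ∂(gaussian d))
      (∫ x, (Real.log (mehler f θ x) + 1) * mehlerDeriv g θ x ∂(gaussian d)) θ := by
  have hcont : ∀ t, Continuous fun x => mehler f t x * Real.log (mehler f t x) := fun t =>
    (H.continuous_mehler t).mul ((H.continuous_mehler t).log fun x => (H.mehler_pos t x).ne')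
  refine (hasDerivAt_integral_of_dominated_loc_of_deriv_le (μ := gaussian d) (x₀ := θ)
    (F := fun θ x => mehler f θ x * Real.log (mehler f θ x))
    (F' := fun θ x => (Real.log (mehler f θ x) + 1) * mehlerDeriv g θ x)
    (bound := fun x => (|Real.log a| + |Real.log b| + 1) * (L * (‖x‖ + ∫ y, ‖y‖ ∂(gaussian d))))
    univ_mem (Eventually.of_forall fun t => (hcont t).aestronglyMeasurable)
    (integrable_of_continuous_of_bound (C := b * (|Real.log a| + |Real.log b| + 1 + 1))
      (hcont θ) fun x => ?_)
    ?_ (ae_of_all _ fun x t _ => ?_) ?_ (ae_of_all _ fun x t _ => ?_)).2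
  · rw [norm_mul]
    refine mul_le_mul (norm_mehler_le H.norm_le θ x) ?_ (norm_nonneg _)
      ((norm_nonneg _).trans (H.norm_le x))
    have := H.abs_log_add_one_le (H.le_mehler θ x) (H.mehler_le θ x)
    have h2 := norm_sub_le (Real.log (mehler f θ x) + 1) 1
    simp only [add_sub_cancel_right, norm_one] at h2
    linarith
  · exact (H.continuous_log_mehler θ).aestronglyMeasurable.mul
      (H.stronglyMeasurable_mehlerDeriv θ).aestronglyMeasurable
  · rw [norm_mul]
    exact mul_le_mul (H.abs_log_add_one_le (H.le_mehler t x) (H.mehler_le t x))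
      (H.norm_mehlerDeriv_le t x) (norm_nonneg _) (by positivity)
  · exact ((integrable_norm_gaussian.add (integrable_const _)).const_mul L).const_mul _
  · have h1 := H.hasDerivAt_mehler t x
    have h2 := h1.mul (h1.log (H.mehler_pos t x).ne')
    refine h2.congr_deriv ?_
    have := (H.mehler_pos t x).ne'
    field_simp

/-- In the rotated variables `(z, y)` the derivative of the entropy contains the factor `⟨g z, y⟩`,
so that Gaussian integration by parts in `y` turns it into a Fisher information. -/
lemma integral_log_mul_mehlerDeriv (H : IsRegular f g a b L) (θ : ℝ) :
    ∫ x, (Real.log (mehler f θ x) + 1) * mehlerDeriv g θ x ∂(gaussian d)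
      = -(Real.sin θ * Real.cos θ) * ∫ x, ‖mehler g θ x‖ ^ 2 / mehler f θ x ∂(gaussian d) := by
  set γ := gaussian d
  set R := ContinuousLinearMap.rotation (E := 𝔼) θ
  have hR : MeasurePreserving R (γ.prod γ) (γ.prod γ) := measurePreserving_rotation θ
  have hback : ∀ p : 𝔼 × 𝔼, Real.cos θ • (R p).1 - Real.sin θ • (R p).2 = p.1 := by
    intro p
    simp only [R, ContinuousLinearMap.rotation_apply]
    have h1 := Real.sin_sq_add_cos_sq θ
    have : (Real.cos θ * Real.cos θ + Real.sin θ * Real.sin θ) • p.1 = p.1 := by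
      rw [← sq, ← sq, add_comm, h1, one_smul]
    conv_rhs => rw [← this]
    module
  -- `Ψ₁` and `Ψ₂` are the integrands before and after the integration by parts.
  let Ψ₁ : 𝔼 × 𝔼 → ℝ := fun p =>
    (Real.log (mehler f θ (Real.cos θ • p.1 - Real.sin θ • p.2)) + 1) * inner ℝ (g p.1) p.2
  let Ψ₂ : 𝔼 × 𝔼 → ℝ := fun p =>
    inner ℝ (mehler g θ (Real.cos θ • p.1 - Real.sin θ • p.2)) (g p.1) /
      mehler f θ (Real.cos θ • p.1 - Real.sin θ • p.2)
  have hc₁ : Continuous Ψ₁ :=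
    ((H.continuous_log_mehler θ).comp (by fun_prop)).mul
      ((H.continuous_gradient.comp continuous_fst).inner continuous_snd)
  have hc₂ : Continuous Ψ₂ :=
    (((H.continuous_mehler_gradient θ).comp (by fun_prop)).inner
      (H.continuous_gradient.comp continuous_fst)).div
      ((H.continuous_mehler θ).comp (by fun_prop)) fun p => (H.mehler_pos θ _).ne'
  have hb₁ : ∀ p, ‖Ψ₁ p‖ ≤ (|Real.log a| + |Real.log b| + 1) * L * ‖p.2‖ := by
    intro p
    rw [norm_mul, mul_assoc]
    refine mul_le_mul (H.abs_log_add_one_le (H.le_mehler θ _) (H.mehler_le θ _)) ?_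
      (norm_nonneg _) (by positivity)
    exact (norm_inner_le_norm _ _).trans
      (mul_le_mul_of_nonneg_right (H.norm_gradient_le _) (norm_nonneg _))
  have hb₂ : ∀ p, ‖Ψ₂ p‖ ≤ L * L / a := by
    intro p
    rw [norm_div]
    refine div_le_div₀ (mul_nonneg H.bound_nonneg H.bound_nonneg) ?_ H.pos ?_
    · exact (norm_inner_le_norm _ _).trans (mul_le_mul (norm_mehler_le H.norm_gradient_le _ _)
        (H.norm_gradient_le _) (norm_nonneg _) H.bound_nonneg)
    · rw [Real.norm_of_nonneg (H.mehler_pos θ _).le]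
      exact H.le_mehler θ _
  have hi₁ : Integrable Ψ₁ (γ.prod γ) := by
    refine Integrable.mono' (g := fun p : 𝔼 × 𝔼 => (|Real.log a| + |Real.log b| + 1) * L * ‖p.2‖)
      ?_ hc₁.aestronglyMeasurable (ae_of_all _ hb₁)
    exact (integrable_norm_gaussian.comp_snd γ).const_mul _
  have hi₂ : Integrable Ψ₂ (γ.prod γ) := integrable_of_continuous_of_bound hc₂ hb₂
  have hrot₁ : ∫ p, Ψ₁ (R p) ∂(γ.prod γ) = ∫ p, Ψ₁ p ∂(γ.prod γ) := by
    conv_rhs => rw [← hR.map_eq]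
    rw [integral_map hR.measurable.aemeasurable hc₁.aestronglyMeasurable]
  have hrot₂ : ∫ p, Ψ₂ (R p) ∂(γ.prod γ) = ∫ p, Ψ₂ p ∂(γ.prod γ) := by
    conv_rhs => rw [← hR.map_eq]
    rw [integral_map hR.measurable.aemeasurable hc₂.aestronglyMeasurable]
  have hlhs : ∫ x, (Real.log (mehler f θ x) + 1) * mehlerDeriv g θ x ∂γ
      = ∫ p, Ψ₁ (R p) ∂(γ.prod γ) := by
    rw [integral_prod (fun p => Ψ₁ (R p)) (hR.integrable_comp_of_integrable hi₁)]
    congr 1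
    ext x
    rw [mehlerDeriv, ← integral_const_mul]
    congr 1
    ext y
    simp only [Ψ₁, hback]
    rfl
  have hrhs : ∫ x, ‖mehler g θ x‖ ^ 2 / mehler f θ x ∂γ = ∫ p, Ψ₂ (R p) ∂(γ.prod γ) := by
    rw [integral_prod (fun p => Ψ₂ (R p)) (hR.integrable_comp_of_integrable hi₂)]
    congr 1
    ext x
    simp only [Ψ₂, hback]
    rw [integral_div]
    congr 1
    rw [← real_inner_self_eq_norm_sq]
    exact (((innerSL ℝ (mehler g θ x)).integral_comp_comm
      (H.integrable_gradient_shift θ x))).symm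
  rw [hlhs, hrhs, hrot₁, hrot₂, integral_prod _ hi₁, integral_prod _ hi₂, ← integral_const_mul]
  congr 1
  ext z
  rw [← integral_const_mul]
  have hder : ∀ y : 𝔼, HasFDerivAt
      (fun y : 𝔼 => Real.log (mehler f θ (Real.cos θ • z - Real.sin θ • y)) + 1)
      ((mehler f θ (Real.cos θ • z - Real.sin θ • y))⁻¹ •
        ((Real.cos θ • innerSL ℝ (mehler g θ (Real.cos θ • z - Real.sin θ • y))).comp
          (-(Real.sin θ • ContinuousLinearMap.id ℝ 𝔼)))) y := by
    intro y
    have h1 : HasFDerivAt (fun y : 𝔼 => Real.cos θ • z - Real.sin θ • y)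
        (-(Real.sin θ • ContinuousLinearMap.id ℝ 𝔼)) y :=
      ((hasFDerivAt_id y).const_smul (Real.sin θ)).const_sub _
    exact (((H.hasFDerivAt_mehler θ _).comp y h1).log (H.mehler_pos θ _).ne').add_const 1
  have hfd : ∀ y : 𝔼, fderiv ℝ
      (fun y : 𝔼 => Real.log (mehler f θ (Real.cos θ • z - Real.sin θ • y)) + 1) y (g z)
      = -(Real.sin θ * Real.cos θ) * Ψ₂ (z, y) := by
    intro y
    rw [(hder y).fderiv]
    simp [Ψ₂]
    ring
  have hibp := integral_mul_inner_gaussian (g z) (fun y => (hder y).differentiableAt)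
    ?_ ?_ ?_
  · refine Eq.trans ?_ (hibp.trans ?_)
    · rfl
    · congr 1
      ext y
      exact hfd y
  · exact integrable_of_continuous_of_bound ((H.continuous_log_mehler θ).comp (by fun_prop))
      fun y => H.abs_log_add_one_le (H.le_mehler θ _) (H.mehler_le θ _)
  · simp_rw [hfd]
    exact (integrable_of_continuous_of_bound (hc₂.comp (by fun_prop : Continuous (z, ·)))
      fun y => hb₂ _).const_mul _
  · exact Integrable.mono' (integrable_norm_gaussian.const_mul _)
      (hc₁.comp (by fun_prop : Continuous (z, ·))).aestronglyMeasurable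
      (ae_of_all _ fun y => hb₁ (z, y))

/-- Cauchy–Schwarz for the jointly convex function `(v, t) ↦ ‖v‖² / t`. -/
lemma norm_sq_mehler_div_le (H : IsRegular f g a b L) (θ : ℝ) (x : 𝔼) :
    ‖mehler g θ x‖ ^ 2 / mehler f θ x ≤ mehler (fun z => ‖g z‖ ^ 2 / f z) θ x := by
  set q := mehler f θ x with hq
  set k := mehler g θ x with hk
  have hqpos : 0 < q := H.mehler_pos θ x
  have hi1 := H.integrable_shift θ x
  have hi2 : Integrable (fun y => (inner ℝ k (g (Real.cos θ • x + Real.sin θ • y)) : ℝ))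
      (gaussian d) := (H.integrable_gradient_shift θ x).const_inner k
  have hi3 : Integrable (fun y => ‖g (Real.cos θ • x + Real.sin θ • y)‖ ^ 2 /
      f (Real.cos θ • x + Real.sin θ • y)) (gaussian d) := by
    refine integrable_of_continuous_of_bound (C := L ^ 2 / a) ?_ fun y => ?_
    · exact ((H.continuous_gradient.comp (by fun_prop)).norm.pow 2).div
        (H.continuous.comp (by fun_prop)) fun y => (H.pos.trans_le (H.le_apply _)).ne'
    · have h0 := H.pos.trans_le (H.le_apply (Real.cos θ • x + Real.sin θ • y))
      rw [Real.norm_of_nonneg (by positivity)]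
      exact div_le_div₀ (by positivity) (pow_le_pow_left₀ (norm_nonneg _) (H.norm_gradient_le _) 2)
        H.pos (H.le_apply _)
  have hmono := integral_mono ((hi2.const_mul (2 / q)).sub (hi1.const_mul (‖k‖ ^ 2 / q ^ 2))) hi3
    (fun y => ?_)
  · simp only [Pi.sub_apply] at hmono
    rw [integral_sub (hi2.const_mul _) (hi1.const_mul _), integral_const_mul, integral_const_mul]
      at hmono
    have e1 : ∫ y, (inner ℝ k (g (Real.cos θ • x + Real.sin θ • y)) : ℝ) ∂(gaussian d)
        = ‖k‖ ^ 2 := by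
      rw [← real_inner_self_eq_norm_sq]
      exact (innerSL ℝ k).integral_comp_comm (H.integrable_gradient_shift θ x)
    have e2 : ∫ y, f (Real.cos θ • x + Real.sin θ • y) ∂(gaussian d) = q := rfl
    rw [e1, e2] at hmono
    refine le_trans (le_of_eq ?_) hmono
    field_simp
    ring
  · simp only [Pi.sub_apply]
    set w := g (Real.cos θ • x + Real.sin θ • y)
    have h0 := H.pos.trans_le (H.le_apply (Real.cos θ • x + Real.sin θ • y))
    set t := f (Real.cos θ • x + Real.sin θ • y)
    have hsq : 0 ≤ ‖w - (t / q) • k‖ ^ 2 := by positivity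
    rw [norm_sub_sq_real, inner_smul_right, norm_smul, Real.norm_of_nonneg (by positivity),
      real_inner_comm] at hsq
    rw [le_div_iff₀ h0]
    have : (2 / q * inner ℝ k w - ‖k‖ ^ 2 / q ^ 2 * t) * t
        = 2 * (t / q * inner ℝ k w) - (t / q * ‖k‖) ^ 2 := by
      field_simp
    linarith

/-- Gaussian logarithmic Sobolev inequality for a regular density: the entropy along `mehler f θ`
interpolates between `f` at `θ = 0` and the constant `∫ f` at `θ = π / 2`. -/
theorem integral_mul_log_le (H : IsRegular f g a b L) :
    ∫ x, f x * Real.log (f x) ∂(gaussian d)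
      - (∫ x, f x ∂(gaussian d)) * Real.log (∫ x, f x ∂(gaussian d))
      ≤ 1 / 2 * ∫ x, ‖g x‖ ^ 2 / f x ∂(gaussian d) := by
  set J := ∫ x, ‖g x‖ ^ 2 / f x ∂(gaussian d)
  let Λ : ℝ → ℝ := fun θ =>
    ∫ x, mehler f θ x * Real.log (mehler f θ x) ∂(gaussian d) + J / 2 * Real.sin θ ^ 2
  have hΛ : ∀ θ, HasDerivAt Λ (-(Real.sin θ * Real.cos θ) *
      ∫ x, ‖mehler g θ x‖ ^ 2 / mehler f θ x ∂(gaussian d)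
      + J / 2 * (2 * Real.sin θ * Real.cos θ)) θ := by
    intro θ
    have h1 := H.hasDerivAt_integral_mehler_mul_log θ
    rw [H.integral_log_mul_mehlerDeriv θ] at h1
    have h2 := ((Real.hasDerivAt_sin θ).pow 2).const_mul (J / 2)
    refine (h1.add h2).congr_deriv ?_
    push_cast
    ring
  have hcJ : Continuous fun z => ‖g z‖ ^ 2 / f z :=
    (H.continuous_gradient.norm.pow 2).div H.continuous
      fun y => (H.pos.trans_le (H.le_apply _)).ne'
  have hbJ : ∀ z, ‖‖g z‖ ^ 2 / f z‖ ≤ L ^ 2 / a := fun z => by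
    have h0 := H.pos.trans_le (H.le_apply z)
    rw [Real.norm_of_nonneg (by positivity)]
    exact div_le_div₀ (by positivity) (pow_le_pow_left₀ (norm_nonneg _) (H.norm_gradient_le _) 2)
      H.pos (H.le_apply _)
  have hJ : ∀ θ, ∫ x, ‖mehler g θ x‖ ^ 2 / mehler f θ x ∂(gaussian d) ≤ J := by
    intro θ
    rw [← show _ = J from integral_mehler hcJ hbJ θ]
    refine integral_mono ?_ ?_ fun x => H.norm_sq_mehler_div_le θ x
    · refine integrable_of_continuous_of_bound (C := L ^ 2 / a) ?_ fun x => ?_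
      · exact ((H.continuous_mehler_gradient θ).norm.pow 2).div (H.continuous_mehler θ)
          fun y => (H.mehler_pos θ _).ne'
      · have h0 := H.mehler_pos θ x
        rw [Real.norm_of_nonneg (by positivity)]
        exact div_le_div₀ (by positivity)
          (pow_le_pow_left₀ (norm_nonneg _) (norm_mehler_le H.norm_gradient_le _ _) 2)
          H.pos (H.le_mehler _ _)
    · exact integrable_of_continuous_of_bound (GaussianLSI.continuous_mehler hcJ hbJ θ)
        fun x => norm_mehler_le hbJ θ x
  have hmono : MonotoneOn Λ (Set.Icc 0 (Real.pi / 2)) := by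
    refine monotoneOn_of_deriv_nonneg (convex_Icc _ _)
      (fun θ _ => (hΛ θ).continuousAt.continuousWithinAt)
      (fun θ _ => (hΛ θ).differentiableAt.differentiableWithinAt) fun θ hθ => ?_
    rw [interior_Icc] at hθ
    rw [(hΛ θ).deriv]
    have hs : 0 ≤ Real.sin θ := Real.sin_nonneg_of_nonneg_of_le_pi hθ.1.le (by
      linarith [hθ.2, Real.pi_pos])
    have hc : 0 ≤ Real.cos θ := Real.cos_nonneg_of_neg_pi_div_two_le_of_le (by
      linarith [hθ.1, Real.pi_pos]) hθ.2.le
    nlinarith [mul_nonneg (mul_nonneg hs hc) (sub_nonneg.2 (hJ θ))]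
  have hfin := hmono (Set.left_mem_Icc.2 (by positivity)) (Set.right_mem_Icc.2 (by positivity))
    (by positivity : (0 : ℝ) ≤ Real.pi / 2)
  simp only [Λ, mehler, Real.cos_zero, Real.sin_zero, Real.cos_pi_div_two, Real.sin_pi_div_two,
    one_smul, zero_smul, zero_add, add_zero, integral_const, probReal_univ] at hfin
  linarith

end IsRegular

/-! ### Compactly supported functions and rescaling -/

/-- `u` is a compactly supported `C¹` function with gradient `g`. -/
structure IsC1c (u : 𝔼 → ℝ) (g : 𝔼 → 𝔼) : Prop where
  hasFDerivAt : ∀ x, HasFDerivAt u (innerSL ℝ (g x)) x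
  continuous_gradient : Continuous g
  hasCompactSupport : HasCompactSupport u

namespace IsC1c

variable {u : EuclideanSpace ℝ (Fin d) → ℝ}
  {g : EuclideanSpace ℝ (Fin d) → EuclideanSpace ℝ (Fin d)}

lemma continuous (H : IsC1c u g) : Continuous u :=
  continuous_iff_continuousAt.2 fun x => (H.hasFDerivAt x).continuousAt

lemma hasCompactSupport_gradient (H : IsC1c u g) : HasCompactSupport g := by
  have h : fderiv ℝ u = fun x => innerSL ℝ (g x) := funext fun x => (H.hasFDerivAt x).fderiv
  have h1 : HasCompactSupport fun x => innerSL ℝ (g x) := h ▸ H.hasCompactSupport.fderiv (𝕜 := ℝ)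
  refine h1.mono fun x hx h0 => hx ?_
  have h2 : ‖innerSL ℝ (g x)‖ = 0 := by
    have : innerSL ℝ (g x) = 0 := h0
    rw [this, norm_zero]
  rwa [innerSL_apply_norm, norm_eq_zero] at h2

lemma integrable_of_mul (H : IsC1c u g) {F : 𝔼 → ℝ} (hF : Continuous F) :
    Integrable (fun x => u x ^ 2 * F x) (gaussian d) := by
  refine Continuous.integrable_of_hasCompactSupport ((H.continuous.pow 2).mul hF) ?_
  refine H.hasCompactSupport.mono fun x hx h0 => hx ?_
  simp [show u x = 0 from h0]

/-- The Gaussian logarithmic Sobolev inequality for `u`, from the regular densities `u² + ε`. -/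
theorem integral_sq_mul_log_le (H : IsC1c u g) :
    ∫ x, u x ^ 2 * Real.log (u x ^ 2) ∂(gaussian d)
      - (∫ x, u x ^ 2 ∂(gaussian d)) * Real.log (∫ x, u x ^ 2 ∂(gaussian d))
      ≤ 2 * ∫ x, ‖g x‖ ^ 2 ∂(gaussian d) := by
  obtain ⟨C, hC⟩ := H.hasCompactSupport.exists_bound_of_continuous H.continuous
  obtain ⟨L, hL⟩ := H.hasCompactSupport_gradient.exists_bound_of_continuous H.continuous_gradient
  have hC0 : 0 ≤ C := (norm_nonneg _).trans (hC 0)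
  have husq : ∀ x, u x ^ 2 ≤ C ^ 2 := fun x => by
    rw [← sq_abs]
    exact pow_le_pow_left₀ (abs_nonneg _) (hC x) 2
  have hint : Integrable (fun x => u x ^ 2) (gaussian d) := by
    simpa using H.integrable_of_mul continuous_const (F := fun _ => 1)
  have hgint : Integrable (fun x => ‖g x‖ ^ 2) (gaussian d) := by
    refine integrable_of_continuous_of_bound (C := L ^ 2) (H.continuous_gradient.norm.pow 2)
      fun x => ?_
    rw [norm_pow, norm_norm]
    exact pow_le_pow_left₀ (norm_nonneg _) (hL x) 2
  have key : ∀ ε : ℝ, 0 < ε →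
      ∫ x, (u x ^ 2 + ε) * Real.log (u x ^ 2 + ε) ∂(gaussian d)
        - (∫ x, u x ^ 2 ∂(gaussian d) + ε) * Real.log (∫ x, u x ^ 2 ∂(gaussian d) + ε)
      ≤ 2 * ∫ x, ‖g x‖ ^ 2 ∂(gaussian d) := by
    intro ε hε
    have hreg : IsRegular (fun x => u x ^ 2 + ε) (fun x => (2 * u x) • g x) ε (C ^ 2 + ε)
        (2 * C * L) := by
      refine ⟨fun x => ?_, (continuous_const.mul H.continuous).smul H.continuous_gradient,
        fun x => ?_, hε, fun x => ?_, fun x => ?_⟩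
      · refine (((H.hasFDerivAt x).pow 2).add_const ε).congr_fderiv ?_
        ext v
        simp
      · rw [norm_smul, norm_mul, Real.norm_two]
        exact mul_le_mul (mul_le_mul_of_nonneg_left (hC x) zero_le_two) (hL x) (norm_nonneg _)
          (by positivity)
      · have := sq_nonneg (u x)
        linarith
      · have := husq x
        linarith
    have h1 := hreg.integral_mul_log_le
    have h2 : ∫ x, (u x ^ 2 + ε) ∂(gaussian d) = ∫ x, u x ^ 2 ∂(gaussian d) + ε := by
      rw [integral_add hint (integrable_const _)]
      simp
    rw [h2] at h1
    have h3 : ∫ x, ‖(2 * u x) • g x‖ ^ 2 / (u x ^ 2 + ε) ∂(gaussian d)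
        ≤ ∫ x, 4 * ‖g x‖ ^ 2 ∂(gaussian d) := by
      refine integral_mono_of_nonneg (ae_of_all _ fun x => ?_) (hgint.const_mul 4)
        (ae_of_all _ fun x => ?_)
      · positivity
      · have h0 := sq_nonneg (u x)
        simp only
        rw [div_le_iff₀ (by positivity), norm_smul, mul_pow, norm_mul, Real.norm_two, mul_pow,
          Real.norm_eq_abs, sq_abs]
        nlinarith [mul_nonneg hε.le (sq_nonneg ‖g x‖)]
    rw [integral_const_mul] at h3
    linarith
  have hφ := Real.continuous_mul_log
  obtain ⟨B, hB⟩ := (isCompact_Icc (a := (0 : ℝ)) (b := C ^ 2 + 1)).exists_bound_of_continuousOn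
    hφ.continuousOn
  have hlim0 : Tendsto (fun n : ℕ => 1 / ((n : ℝ) + 1)) atTop (𝓝 0) :=
    tendsto_one_div_add_atTop_nhds_zero_nat
  have hadd : ∀ c : ℝ, Tendsto (fun n : ℕ => c + 1 / ((n : ℝ) + 1)) atTop (𝓝 c) := fun c => by
    simpa using hlim0.const_add c
  have hlim1 : Tendsto (fun n : ℕ => ∫ x, (u x ^ 2 + 1 / ((n : ℝ) + 1)) *
      Real.log (u x ^ 2 + 1 / ((n : ℝ) + 1)) ∂(gaussian d)) atTop
      (𝓝 (∫ x, u x ^ 2 * Real.log (u x ^ 2) ∂(gaussian d))) := by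
    refine tendsto_integral_of_dominated_convergence (fun _ => B) (fun n => ?_)
      (integrable_const _) (fun n => ae_of_all _ fun x => hB _ ⟨?_, ?_⟩) (ae_of_all _ fun x => ?_)
    · exact (hφ.comp ((H.continuous.pow 2).add continuous_const)).aestronglyMeasurable
    · positivity
    · have : 1 / ((n : ℝ) + 1) ≤ 1 := by
        rw [div_le_one (by positivity)]
        have : (0 : ℝ) ≤ n := n.cast_nonneg
        linarith
      exact add_le_add (husq x) this
    · exact (hφ.tendsto _).comp (hadd _)
  refine le_of_tendsto (hlim1.sub ((hφ.tendsto _).comp (hadd _))) (Eventually.of_forall fun n => ?_)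
  exact key _ (by positivity)

/-- Integration by parts against the Ornstein–Uhlenbeck drift: `x` is the gradient of `‖x‖² / 2`. -/
lemma integral_mul_inner_gradient (H : IsC1c u g) :
    2 * ∫ x, u x * inner ℝ (g x) x ∂(gaussian d)
      = ∫ x, u x ^ 2 * ‖x‖ ^ 2 ∂(gaussian d) - d * ∫ x, u x ^ 2 ∂(gaussian d) := by
  have hpt : ∀ (i : Fin d) (x : 𝔼), HasFDerivAt (fun x : 𝔼 => u x ^ 2 * x i)
      (u x ^ 2 • (EuclideanSpace.proj i : 𝔼 →L[ℝ] ℝ) + x i • ((2 * u x) • innerSL ℝ (g x))) x := by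
    intro i x
    have h1 : HasFDerivAt (fun x : 𝔼 => x i) (EuclideanSpace.proj i : 𝔼 →L[ℝ] ℝ) x :=
      (EuclideanSpace.proj i : 𝔼 →L[ℝ] ℝ).hasFDerivAt
    have h2 := (H.hasFDerivAt x).pow 2
    refine (h2.mul h1).congr_fderiv ?_
    ext v
    simp
  have hfd : ∀ (i : Fin d) (x : 𝔼), fderiv ℝ (fun x : 𝔼 => u x ^ 2 * x i) x
      (EuclideanSpace.single i 1) = u x ^ 2 + 2 * (u x * (g x i * x i)) := by
    intro i x
    rw [(hpt i x).fderiv]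
    simp [EuclideanSpace.inner_single_right]
    ring
  have hcs : ∀ {F : 𝔼 → ℝ}, Continuous F → Integrable (fun x => u x * F x) (gaussian d) := by
    intro F hF
    refine Continuous.integrable_of_hasCompactSupport (H.continuous.mul hF) ?_
    exact H.hasCompactSupport.mul_right
  have hcg : ∀ i, Continuous fun x => g x i := fun i =>
    (EuclideanSpace.proj i : 𝔼 →L[ℝ] ℝ).continuous.comp H.continuous_gradient
  have hcx : ∀ i, Continuous fun x : 𝔼 => x i := fun i =>
    (EuclideanSpace.proj i : 𝔼 →L[ℝ] ℝ).continuous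
  have hint : Integrable (fun x => u x ^ 2) (gaussian d) := by
    simpa using H.integrable_of_mul continuous_const (F := fun _ => 1)
  have hxx : ∀ i : Fin d, Integrable (fun x : 𝔼 => u x ^ 2 * (x i * x i)) (gaussian d) := fun i =>
    H.integrable_of_mul ((hcx i).mul (hcx i))
  have hgx : ∀ i : Fin d, Integrable (fun x : 𝔼 => u x * (g x i * x i)) (gaussian d) := fun i =>
    hcs ((hcg i).mul (hcx i))
  have hi : ∀ i : Fin d, ∫ x, u x ^ 2 * (x i * x i) ∂(gaussian d)
      = ∫ x, u x ^ 2 ∂(gaussian d) + 2 * ∫ x, u x * (g x i * x i) ∂(gaussian d) := by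
    intro i
    have h := integral_mul_inner_gaussian (EuclideanSpace.single i (1 : ℝ))
      (fun x => (hpt i x).differentiableAt) (H.integrable_of_mul (hcx i)) ?_ ?_
    · simp_rw [hfd] at h
      rw [integral_add hint ((hgx i).const_mul 2), integral_const_mul] at h
      rw [← h]
      congr 1
      ext x
      simp [EuclideanSpace.inner_single_left, mul_assoc]
    · simp_rw [hfd]
      exact hint.add ((hgx i).const_mul 2)
    · refine (hxx i).congr (ae_of_all _ fun x => ?_)
      simp [EuclideanSpace.inner_single_left, mul_assoc]
  have hM : ∫ x, u x ^ 2 * ‖x‖ ^ 2 ∂(gaussian d)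
      = ∑ i, ∫ x, u x ^ 2 * (x i * x i) ∂(gaussian d) := by
    rw [← integral_finsetSum _ fun i _ => hxx i]
    congr 1
    ext x
    rw [EuclideanSpace.real_norm_sq_eq, Finset.mul_sum]
    simp_rw [sq (x _)]
  have hI : ∫ x, u x * inner ℝ (g x) x ∂(gaussian d)
      = ∑ i, ∫ x, u x * (g x i * x i) ∂(gaussian d) := by
    rw [← integral_finsetSum _ fun i _ => hgx i]
    congr 1
    ext x
    rw [PiLp.inner_apply, Finset.mul_sum]
    simp [mul_comm]
  rw [hM, hI, Finset.sum_congr rfl fun i _ => hi i, Finset.sum_add_distrib, Finset.mul_sum]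
  simp

end IsC1c

/-- The substitution `y = σ x` turns `γ` into the Gaussian measure of variance `σ²`. -/
lemma integral_exp_mul_comp_smul {σ : ℝ} (hσ : 0 < σ) (F : 𝔼 → ℝ) :
    ∫ x, Real.exp ((1 - σ ^ 2) / 2 * ‖x‖ ^ 2) * F (σ • x) ∂(gaussian d)
      = (σ ^ d)⁻¹ * ∫ x, F x ∂(gaussian d) := by
  rw [integral_gaussian, integral_gaussian]
  have h : ∀ x : 𝔼, gaussianDensity d x • (Real.exp ((1 - σ ^ 2) / 2 * ‖x‖ ^ 2) * F (σ • x))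
      = gaussianDensity d (σ • x) • F (σ • x) := by
    intro x
    rw [smul_eq_mul, smul_eq_mul, ← mul_assoc]
    congr 1
    unfold gaussianDensity
    rw [mul_assoc, ← Real.exp_add, norm_smul, Real.norm_of_nonneg hσ.le]
    congr 2
    ring
  simp_rw [h]
  rw [Measure.integral_comp_smul volume (fun x => gaussianDensity d x • F x) σ,
    finrank_euclideanSpace, Fintype.card_fin, abs_of_nonneg (by positivity), smul_eq_mul]

/-- The upper bound for `∫ u² log u² dγ` given by the logarithmic Sobolev inequality for the
Gaussian measure of variance `τ`, in terms of `m = ∫ u² dγ`, `M = ∫ ‖x‖² u² dγ` and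
`I = ∫ ‖∇u‖² dγ`. -/
noncomputable def lsiBound (d : ℕ) (τ m M I : ℝ) : ℝ :=
  m * Real.log m + 2 * τ * I + (1 - τ) / 2 * M - d * (1 - τ) * m - d / 2 * Real.log τ * m

/-- The logarithmic Sobolev inequality applied to the rescaled function
`x ↦ u (σ x) exp ((1 - σ²) ‖x‖² / 4)` with `σ² = τ`. -/
theorem IsC1c.integral_sq_mul_log_le_lsiBound {u : 𝔼 → ℝ} {g : 𝔼 → 𝔼} (H : IsC1c u g) {τ : ℝ}
    (hτ : 0 < τ) :
    ∫ x, u x ^ 2 * Real.log (u x ^ 2) ∂(gaussian d) ≤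
      lsiBound d τ (∫ x, u x ^ 2 ∂(gaussian d)) (∫ x, u x ^ 2 * ‖x‖ ^ 2 ∂(gaussian d))
        (∫ x, ‖g x‖ ^ 2 ∂(gaussian d)) := by
  obtain ⟨σ, hσ, rfl⟩ : ∃ σ : ℝ, 0 < σ ∧ σ ^ 2 = τ := ⟨√τ, Real.sqrt_pos.2 hτ, Real.sq_sqrt hτ.le⟩
  set κ := (1 - σ ^ 2) / 4 with hκ
  have hκ2 : (1 - σ ^ 2) / 2 = 2 * κ := by rw [hκ]; ring
  have hcov := fun F : 𝔼 → ℝ => integral_exp_mul_comp_smul (d := d) hσ F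
  rw [hκ2] at hcov
  have hexp : ∀ x : 𝔼, Real.exp (κ * ‖x‖ ^ 2) ^ 2 = Real.exp (2 * κ * ‖x‖ ^ 2) := fun x => by
    rw [← Real.exp_nat_mul]
    congr 1
    push_cast
    ring
  have hcsm : Continuous fun x : 𝔼 => σ • x := continuous_const_smul σ
  have hce : Continuous fun x : 𝔼 => Real.exp (κ * ‖x‖ ^ 2) := by fun_prop
  let v : 𝔼 → ℝ := fun x => Real.exp (κ * ‖x‖ ^ 2) * u (σ • x)
  let gv : 𝔼 → 𝔼 := fun x =>
    Real.exp (κ * ‖x‖ ^ 2) • (σ • g (σ • x) + (2 * κ / σ * u (σ • x)) • (σ • x))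
  have Hv : IsC1c v gv := by
    refine ⟨fun x => ?_, ?_, ?_⟩
    · have h1 := ((hasStrictFDerivAt_norm_sq x).hasFDerivAt.const_mul κ).exp
      have h2 : HasFDerivAt (fun x : 𝔼 => σ • x) (σ • ContinuousLinearMap.id ℝ 𝔼) x :=
        (hasFDerivAt_id x).const_smul σ
      refine (h1.mul ((H.hasFDerivAt (σ • x)).comp x h2)).congr_fderiv ?_
      ext w
      simp [gv]
      field_simp
    · have h3 := H.continuous.comp hcsm
      have h4 := H.continuous_gradient.comp hcsm
      exact hce.smul ((h4.const_smul σ).add ((continuous_const.mul h3).smul hcsm))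
    · exact (H.hasCompactSupport.comp_homeomorph (Homeomorph.smulOfNeZero σ hσ.ne')).mul_left
  have hint : Integrable (fun x => u x ^ 2) (gaussian d) := by
    simpa using H.integrable_of_mul continuous_const (F := fun _ => 1)
  have hintM : Integrable (fun x => u x ^ 2 * ‖x‖ ^ 2) (gaussian d) :=
    H.integrable_of_mul (by fun_prop)
  have hintE : Integrable (fun x => u x ^ 2 * Real.log (u x ^ 2)) (gaussian d) := by
    refine (Real.continuous_mul_log.comp (H.continuous.pow 2)).integrable_of_hasCompactSupport ?_
    refine H.hasCompactSupport.mono fun x hx h0 => hx ?_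
    simp [show u x = 0 from h0]
  have hintG : Integrable (fun x => ‖g x‖ ^ 2) (gaussian d) := by
    refine (H.continuous_gradient.norm.pow 2).integrable_of_hasCompactSupport ?_
    refine H.hasCompactSupport_gradient.mono fun x hx h0 => hx ?_
    simp [show g x = 0 from h0]
  have hintC : Integrable (fun x => u x * inner ℝ (g x) x) (gaussian d) := by
    refine (H.continuous.mul (H.continuous_gradient.inner
      continuous_id)).integrable_of_hasCompactSupport ?_
    exact H.hasCompactSupport.mul_right
  have hE : ∫ x, v x ^ 2 * Real.log (v x ^ 2) ∂(gaussian d) = (σ ^ d)⁻¹ *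
      (∫ x, u x ^ 2 * Real.log (u x ^ 2) ∂(gaussian d)
        + 2 * κ / σ ^ 2 * ∫ x, u x ^ 2 * ‖x‖ ^ 2 ∂(gaussian d)) := by
    rw [← integral_const_mul, ← integral_add hintE (hintM.const_mul _), ← hcov]
    congr 1
    ext x
    simp only [v, mul_pow, hexp, norm_smul, Real.norm_of_nonneg hσ.le]
    by_cases h0 : u (σ • x) = 0
    · simp [h0]
    · rw [Real.log_mul (Real.exp_pos _).ne' (pow_ne_zero 2 h0), Real.log_exp]
      field_simp
      ring
  have hm : ∫ x, v x ^ 2 ∂(gaussian d) = (σ ^ d)⁻¹ * ∫ x, u x ^ 2 ∂(gaussian d) := by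
    rw [← hcov]
    simp only [v, mul_pow, hexp]
  have hsum : Integrable (fun x => σ ^ 2 * ‖g x‖ ^ 2 + 4 * κ * (u x * inner ℝ (g x) x))
      (gaussian d) := (hintG.const_mul _).add (hintC.const_mul _)
  have hG : ∫ x, ‖gv x‖ ^ 2 ∂(gaussian d) = (σ ^ d)⁻¹ *
      (σ ^ 2 * ∫ x, ‖g x‖ ^ 2 ∂(gaussian d) + 4 * κ * ∫ x, u x * inner ℝ (g x) x ∂(gaussian d)
        + (2 * κ / σ) ^ 2 * ∫ x, u x ^ 2 * ‖x‖ ^ 2 ∂(gaussian d)) := by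
    rw [← integral_const_mul, ← integral_const_mul, ← integral_const_mul,
      ← integral_add (hintG.const_mul _) (hintC.const_mul _), ← integral_add hsum
        (hintM.const_mul _), ← hcov]
    congr 1
    ext x
    simp only [gv]
    rw [norm_smul, mul_pow, Real.norm_of_nonneg (Real.exp_pos _).le, hexp, norm_add_sq_real]
    congr 1
    set y := σ • x
    rw [norm_smul, norm_smul, inner_smul_left, inner_smul_right, mul_pow, mul_pow,
      Real.norm_eq_abs, Real.norm_eq_abs, sq_abs, sq_abs]
    simp
    field_simp
    ring
  have hlsi := Hv.integral_sq_mul_log_le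
  have hibp := H.integral_mul_inner_gradient
  rw [hE, hm, hG] at hlsi
  set m := ∫ x, u x ^ 2 ∂(gaussian d)
  set M := ∫ x, u x ^ 2 * ‖x‖ ^ 2 ∂(gaussian d)
  set I := ∫ x, ‖g x‖ ^ 2 ∂(gaussian d)
  set X := ∫ x, u x * inner ℝ (g x) x ∂(gaussian d)
  set T := ∫ x, u x ^ 2 * Real.log (u x ^ 2) ∂(gaussian d)
  have hlog : m * Real.log ((σ ^ d)⁻¹ * m) = m * Real.log m - d * Real.log σ * m := by
    by_cases h0 : m = 0
    · simp [h0]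
    · rw [Real.log_mul (by positivity) h0, Real.log_inv, Real.log_pow]
      ring
  have hX : X = (M - d * m) / 2 := by linarith
  rw [mul_assoc, hlog, ← mul_sub, mul_left_comm, mul_le_mul_iff_right₀ (by positivity), hX] at hlsi
  unfold lsiBound
  rw [Real.log_pow]
  push_cast
  have e : (2 * κ / σ) ^ 2 = 4 * κ ^ 2 / σ ^ 2 := by ring
  have e2 : 2 * (4 * κ ^ 2 / σ ^ 2) * M - 2 * κ / σ ^ 2 * M = -2 * κ * M := by
    rw [hκ]
    field_simp
    ring
  rw [e] at hlsi
  rw [hκ] at hlsi e2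
  nlinarith [hlsi, e2]

/-! ### Stability under limits -/

/-- The logarithmic Sobolev inequality with parameter `τ` for `u` with gradient `G`, including the
convergence of the entropy integral. -/
def SatisfiesLSI (τ : ℝ) (u : 𝔼 → ℝ) (G : 𝔼 → 𝔼) : Prop :=
  Integrable (fun x => u x ^ 2 * Real.log (u x ^ 2)) (gaussian d) ∧
    ∫ x, u x ^ 2 * Real.log (u x ^ 2) ∂(gaussian d) ≤
      lsiBound d τ (∫ x, u x ^ 2 ∂(gaussian d)) (∫ x, u x ^ 2 * ‖x‖ ^ 2 ∂(gaussian d))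
        (∫ x, ‖G x‖ ^ 2 ∂(gaussian d))

lemma sub_one_le_mul_log {t : ℝ} (ht : 0 ≤ t) : t - 1 ≤ t * Real.log t := by
  rcases ht.eq_or_lt with rfl | h
  · simp
  · have h1 := mul_le_mul_of_nonneg_left (Real.one_sub_inv_le_log_of_pos h) h.le
    rwa [mul_sub, mul_inv_cancel₀ h.ne', mul_one] at h1

section Fatou

variable {α : Type*} [MeasurableSpace α] {μ : Measure α}

lemma ofReal_integral_le_liminf {f : α → ℝ} {F : ℕ → α → ℝ} (hF : ∀ n, Integrable (F n) μ)
    (hF0 : ∀ n x, 0 ≤ F n x) (hlim : ∀ᵐ x ∂μ, Tendsto (fun n => F n x) atTop (𝓝 (f x))) :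
    ∫⁻ x, ENNReal.ofReal (f x) ∂μ ≤ liminf (fun n => ENNReal.ofReal (∫ x, F n x ∂μ)) atTop := by
  have h1 := lintegral_liminf_le' (u := atTop) (μ := μ)
    (f := fun n x => ENNReal.ofReal (F n x)) fun n => (hF n).aemeasurable.ennreal_ofReal
  have h2 : ∫⁻ x, liminf (fun n => ENNReal.ofReal (F n x)) atTop ∂μ
      = ∫⁻ x, ENNReal.ofReal (f x) ∂μ := by
    refine lintegral_congr_ae ?_
    filter_upwards [hlim] with x hx
    exact ((ENNReal.continuous_ofReal.tendsto _).comp hx).liminf_eq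
  rw [h2] at h1
  refine h1.trans_eq ?_
  congr 1
  ext n
  exact (ofReal_integral_eq_lintegral_ofReal (hF n) (ae_of_all _ (hF0 n))).symm

/-- Fatou's lemma for nonnegative functions whose integrals are eventually bounded. -/
lemma integrable_and_integral_le_of_tendsto {f : α → ℝ} {F : ℕ → α → ℝ} {c : ℕ → ℝ} {C : ℝ}
    (hF : ∀ n, Integrable (F n) μ) (hF0 : ∀ n x, 0 ≤ F n x) (hf0 : ∀ x, 0 ≤ f x)
    (hf : AEStronglyMeasurable f μ)
    (hlim : ∀ᵐ x ∂μ, Tendsto (fun n => F n x) atTop (𝓝 (f x)))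
    (hc : ∀ᶠ n in atTop, ∫ x, F n x ∂μ ≤ c n) (hC : Tendsto c atTop (𝓝 C)) :
    Integrable f μ ∧ ∫ x, f x ∂μ ≤ C := by
  have hC0 : 0 ≤ C := by
    refine ge_of_tendsto hC ?_
    filter_upwards [hc] with n hn
    exact (integral_nonneg (hF0 n)).trans hn
  have h1 : ∫⁻ x, ENNReal.ofReal (f x) ∂μ ≤ ENNReal.ofReal C := by
    refine (ofReal_integral_le_liminf hF hF0 hlim).trans ?_
    rw [← ((ENNReal.continuous_ofReal.tendsto _).comp hC).liminf_eq]
    refine liminf_le_liminf ?_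
    filter_upwards [hc] with n hn
    exact ENNReal.ofReal_le_ofReal hn
  have h2 : Integrable f μ := by
    refine ⟨hf, ?_⟩
    rw [hasFiniteIntegral_iff_ofReal (ae_of_all _ hf0)]
    exact h1.trans_lt ENNReal.ofReal_lt_top
  refine ⟨h2, ?_⟩
  rw [← ofReal_integral_eq_lintegral_ofReal h2 (ae_of_all _ hf0)] at h1
  exact (ENNReal.ofReal_le_ofReal_iff hC0).1 h1

/-- If the upper bound in Fatou's lemma is attained in the limit, the integrals converge. -/
lemma tendsto_integral_of_eventually_le {f : α → ℝ} {F : ℕ → α → ℝ}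
    (hF : ∀ n, Integrable (F n) μ) (hF0 : ∀ n x, 0 ≤ F n x) (hf0 : ∀ x, 0 ≤ f x)
    (hf : Integrable f μ) (hlim : ∀ᵐ x ∂μ, Tendsto (fun n => F n x) atTop (𝓝 (f x)))
    (hle : ∀ c, ∫ x, f x ∂μ < c → ∀ᶠ n in atTop, ∫ x, F n x ∂μ < c) :
    Tendsto (fun n => ∫ x, F n x ∂μ) atTop (𝓝 (∫ x, f x ∂μ)) := by
  refine tendsto_order.2 ⟨fun a ha => ?_, hle⟩
  rcases lt_or_ge a 0 with h0 | h0
  · exact Eventually.of_forall fun n => h0.trans_le (integral_nonneg (hF0 n))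
  · have h1 := ofReal_integral_le_liminf hF hF0 hlim
    rw [← ofReal_integral_eq_lintegral_ofReal hf (ae_of_all _ hf0)] at h1
    have h2 : ENNReal.ofReal a < liminf (fun n => ENNReal.ofReal (∫ x, F n x ∂μ)) atTop :=
      ((ENNReal.ofReal_lt_ofReal_iff (h0.trans_lt ha)).2 ha).trans_le h1
    filter_upwards [eventually_lt_of_lt_liminf h2] with n hn
    exact (ENNReal.ofReal_lt_ofReal_iff_of_nonneg h0).1 hn

end Fatou

/-- The logarithmic Sobolev inequality is stable under almost everywhere convergence, provided the
mass converges and the second moment and the Dirichlet energy do not increase in the limit. -/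
lemma satisfiesLSI_of_tendsto {τ : ℝ} (hτ : 0 < τ) (hτ1 : τ ≤ 1) {u : 𝔼 → ℝ} {G : 𝔼 → 𝔼}
    {v : ℕ → 𝔼 → ℝ} {H : ℕ → 𝔼 → 𝔼} (hv : ∀ n, SatisfiesLSI τ (v n) (H n))
    (hu : AEStronglyMeasurable u (gaussian d))
    (hlim : ∀ᵐ x ∂(gaussian d), Tendsto (fun n => v n x) atTop (𝓝 (u x)))
    (hm : Tendsto (fun n => ∫ x, v n x ^ 2 ∂(gaussian d)) atTop (𝓝 (∫ x, u x ^ 2 ∂(gaussian d))))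
    (hM : ∀ c, ∫ x, u x ^ 2 * ‖x‖ ^ 2 ∂(gaussian d) < c →
      ∀ᶠ n in atTop, ∫ x, v n x ^ 2 * ‖x‖ ^ 2 ∂(gaussian d) < c)
    (hI : ∀ c, ∫ x, ‖G x‖ ^ 2 ∂(gaussian d) < c →
      ∀ᶠ n in atTop, ∫ x, ‖H n x‖ ^ 2 ∂(gaussian d) < c) :
    SatisfiesLSI τ u G := by
  set m := ∫ x, u x ^ 2 ∂(gaussian d)
  set M := ∫ x, u x ^ 2 * ‖x‖ ^ 2 ∂(gaussian d)
  set I := ∫ x, ‖G x‖ ^ 2 ∂(gaussian d)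
  have hφ := Real.continuous_mul_log
  have hv1 : ∀ n, Integrable (fun x => v n x ^ 2 * Real.log (v n x ^ 2)) (gaussian d) :=
    fun n => (hv n).1
  have hv2 : ∀ n, Integrable (fun x => v n x ^ 2 * Real.log (v n x ^ 2) + 1) (gaussian d) :=
    fun n => Integrable.add (hv1 n) (integrable_const (1 : ℝ))
  have hu2 : AEStronglyMeasurable (fun x => u x ^ 2) (gaussian d) :=
    (continuous_pow 2).comp_aestronglyMeasurable hu
  have hu3 : AEStronglyMeasurable (fun x => u x ^ 2 * Real.log (u x ^ 2)) (gaussian d) :=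
    hφ.comp_aestronglyMeasurable hu2
  have key : ∀ ε > 0, Integrable (fun x => u x ^ 2 * Real.log (u x ^ 2) + 1) (gaussian d) ∧
      ∫ x, (u x ^ 2 * Real.log (u x ^ 2) + 1) ∂(gaussian d)
        ≤ lsiBound d τ m (M + ε) (I + ε) + 1 := by
    intro ε hε
    refine integrable_and_integral_le_of_tendsto
      (F := fun n x => v n x ^ 2 * Real.log (v n x ^ 2) + 1)
      (c := fun n => lsiBound d τ (∫ x, v n x ^ 2 ∂(gaussian d)) (M + ε) (I + ε) + 1)
      hv2 (fun n x => ?_) (fun x => ?_) ?_ ?_ ?_ ?_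
    · linarith [sub_one_le_mul_log (sq_nonneg (v n x)), sq_nonneg (v n x)]
    · linarith [sub_one_le_mul_log (sq_nonneg (u x)), sq_nonneg (u x)]
    · exact hu3.add aestronglyMeasurable_const
    · filter_upwards [hlim] with x hx
      exact ((hφ.tendsto _).comp (hx.pow 2)).add_const 1
    · filter_upwards [hM (M + ε) (by linarith), hI (I + ε) (by linarith)] with n h1 h2
      rw [integral_add (hv1 n) (integrable_const (1 : ℝ))]
      have h3 := (hv n).2
      simp only [integral_const, probReal_univ, smul_eq_mul, mul_one]
      unfold lsiBound at h3 ⊢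
      nlinarith [mul_le_mul_of_nonneg_left h1.le (by linarith : 0 ≤ (1 - τ) / 2),
        mul_le_mul_of_nonneg_left h2.le (by linarith : 0 ≤ 2 * τ)]
    · refine Tendsto.add_const 1 ?_
      have hcont : Continuous fun t => lsiBound d τ t (M + ε) (I + ε) := by
        unfold lsiBound
        fun_prop
      exact (hcont.tendsto m).comp hm
  have hint : Integrable (fun x => u x ^ 2 * Real.log (u x ^ 2)) (gaussian d) := by
    refine ((key 1 one_pos).1.sub (integrable_const (1 : ℝ))).congr (ae_of_all _ fun x => ?_)
    simp only [Pi.sub_apply, add_sub_cancel_right]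
  refine ⟨hint, ?_⟩
  have hb : ∀ ε > 0, ∫ x, u x ^ 2 * Real.log (u x ^ 2) ∂(gaussian d)
      ≤ lsiBound d τ m (M + ε) (I + ε) := by
    intro ε hε
    have h := (key ε hε).2
    rw [integral_add hint (integrable_const (1 : ℝ))] at h
    simp only [integral_const, probReal_univ, smul_eq_mul, mul_one] at h
    linarith
  have hcont : Continuous fun ε => lsiBound d τ m (M + ε) (I + ε) := by
    unfold lsiBound
    fun_prop
  have hlim0 := (hcont.tendsto 0).mono_left (nhdsWithin_le_nhds (s := Set.Ioi 0))
  simp only [add_zero] at hlim0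
  exact ge_of_tendsto hlim0 (eventually_mem_nhdsWithin.mono fun ε hε => hb ε hε)

/-! ### Mollification -/

section Mollify

variable {F : Type*} [NormedAddCommGroup F] [NormedSpace ℝ F]

/-- The mollification of `h` by a normalized smooth bump function. -/
noncomputable def mollify (ρ : ContDiffBump (0 : EuclideanSpace ℝ (Fin d)))
    (h : EuclideanSpace ℝ (Fin d) → F) : EuclideanSpace ℝ (Fin d) → F :=
  convolution (ρ.normed volume) h (ContinuousLinearMap.lsmul ℝ ℝ) volume

lemma lintegral_normed (ρ : ContDiffBump (0 : 𝔼)) :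
    ∫⁻ t, ENNReal.ofReal (ρ.normed volume t) = 1 := by
  rw [← ofReal_integral_eq_lintegral_ofReal ρ.integrable_normed
    (ae_of_all _ fun x => ρ.nonneg_normed x), ρ.integral_normed, ENNReal.ofReal_one]

/-- Jensen's inequality for the average defining the mollification. -/
lemma enorm_mollify_sq_le (ρ : ContDiffBump (0 : 𝔼)) {h : 𝔼 → F}
    (hm : AEStronglyMeasurable h volume) (x : 𝔼) :
    ‖mollify ρ h x‖ₑ ^ 2
      ≤ ∫⁻ t, ENNReal.ofReal (ρ.normed volume t) * ‖h (x - t)‖ₑ ^ 2 := by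
  set ν : Measure 𝔼 := volume.withDensity fun t => ENNReal.ofReal (ρ.normed volume t)
  have hρm : Measurable fun t => ENNReal.ofReal (ρ.normed volume t) :=
    ρ.continuous_normed.measurable.ennreal_ofReal
  have hν : IsProbabilityMeasure ν := ⟨by
    rw [withDensity_apply _ MeasurableSet.univ, Measure.restrict_univ, lintegral_normed]⟩
  have hmx : AEStronglyMeasurable (fun t => h (x - t)) ν :=
    (hm.comp_quasiMeasurePreserving
      (quasiMeasurePreserving_sub_left_of_right_invariant volume x)).mono_ac
      (withDensity_absolutelyContinuous _ _)
  have h1 : mollify ρ h x = ∫ t, h (x - t) ∂ν := by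
    rw [integral_withDensity_eq_integral_toReal_smul hρm (by simp)]
    simp only [ENNReal.toReal_ofReal (ρ.nonneg_normed _)]
    rfl
  have h2 : ‖mollify ρ h x‖ₑ ≤ eLpNorm (fun t => h (x - t)) 2 ν := by
    rw [h1]
    refine (enorm_integral_le_lintegral_enorm _).trans ?_
    rw [← eLpNorm_one_eq_lintegral_enorm]
    exact eLpNorm_le_eLpNorm_of_exponent_le one_le_two hmx
  refine (pow_le_pow_left' h2 2).trans_eq ?_
  have h3 := eLpNorm_nnreal_pow_eq_lintegral (μ := ν) (f := fun t => h (x - t)) (p := 2) two_ne_zero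
  simp only [NNReal.coe_ofNat, ENNReal.rpow_ofNat, ENNReal.coe_ofNat] at h3
  rw [h3, lintegral_withDensity_eq_lintegral_mul_non_measurable]
  · rfl
  · exact hρm
  · simp

/-- Mollification increases a weighted `L²` norm by at most the factor by which the weight varies at
the scale of the mollifier. -/
lemma lintegral_enorm_mollify_sq_le (ρ : ContDiffBump (0 : 𝔼)) {h : 𝔼 → F}
    (hm : AEStronglyMeasurable h volume) {w : 𝔼 → ℝ} (hw : Continuous w) {A R : ℝ} (hA : 0 ≤ A)
    (hR : ∀ y, R < ‖y‖ → h y = 0)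
    (hwA : ∀ y t : 𝔼, ‖y‖ ≤ R → ‖t‖ ≤ ρ.rOut → w (y + t) ≤ A * w y) :
    ∫⁻ x, ENNReal.ofReal (w x) * ‖mollify ρ h x‖ₑ ^ 2
      ≤ ENNReal.ofReal A * ∫⁻ x, ENNReal.ofReal (w x) * ‖h x‖ₑ ^ 2 := by
  have hwm : Measurable fun t => ENNReal.ofReal (w t) := hw.measurable.ennreal_ofReal
  have hρm : Measurable fun t => ENNReal.ofReal (ρ.normed volume t) :=
    ρ.continuous_normed.measurable.ennreal_ofReal
  have hhm : AEMeasurable (fun p : 𝔼 × 𝔼 => ‖h (p.1 - p.2)‖ₑ ^ 2) (volume.prod volume) :=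
    ((hm.comp_quasiMeasurePreserving
      (quasiMeasurePreserving_sub_of_right_invariant volume volume)).enorm).pow_const 2
  calc ∫⁻ x, ENNReal.ofReal (w x) * ‖mollify ρ h x‖ₑ ^ 2
      ≤ ∫⁻ x, ∫⁻ t, ENNReal.ofReal (w x) *
          (ENNReal.ofReal (ρ.normed volume t) * ‖h (x - t)‖ₑ ^ 2) := by
        refine lintegral_mono fun x => ?_
        rw [lintegral_const_mul' _ _ ENNReal.ofReal_ne_top]
        exact mul_le_mul_right (enorm_mollify_sq_le ρ hm x) _
    _ = ∫⁻ t, ∫⁻ x, ENNReal.ofReal (w x) *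
          (ENNReal.ofReal (ρ.normed volume t) * ‖h (x - t)‖ₑ ^ 2) := by
        refine lintegral_lintegral_swap ?_
        exact (hwm.comp measurable_fst).aemeasurable.mul
          ((hρm.comp measurable_snd).aemeasurable.mul hhm)
    _ ≤ ∫⁻ t, ENNReal.ofReal (ρ.normed volume t) *
          (ENNReal.ofReal A * ∫⁻ x, ENNReal.ofReal (w x) * ‖h x‖ₑ ^ 2) := by
        refine lintegral_mono fun t => ?_
        have htr := lintegral_sub_right_eq_self (μ := (volume : Measure 𝔼))
          (fun y => ENNReal.ofReal (w (y + t)) *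
            (ENNReal.ofReal (ρ.normed volume t) * ‖h y‖ₑ ^ 2)) t
        simp only [sub_add_cancel] at htr
        simp only
        rw [htr, ← lintegral_const_mul' _ _ ENNReal.ofReal_ne_top,
          ← lintegral_const_mul' _ _ ENNReal.ofReal_ne_top]
        refine lintegral_mono fun y => ?_
        by_cases hy : R < ‖y‖
        · simp [hR y hy]
        by_cases ht : ‖t‖ ≤ ρ.rOut
        · have := ENNReal.ofReal_le_ofReal (hwA y t (not_lt.1 hy) ht)
          rw [ENNReal.ofReal_mul hA] at this
          calc _ ≤ (ENNReal.ofReal A * ENNReal.ofReal (w y)) *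
                (ENNReal.ofReal (ρ.normed volume t) * ‖h y‖ₑ ^ 2) := mul_le_mul_left this _
            _ = _ := by ring
        · have h0 : ρ.normed volume t = 0 := by
            rw [← Function.notMem_support, ρ.support_normed_eq]
            simpa using (not_le.1 ht).le
          simp [h0]
    _ = ENNReal.ofReal A * ∫⁻ x, ENNReal.ofReal (w x) * ‖h x‖ₑ ^ 2 := by
        rw [lintegral_mul_const _ hρm, lintegral_normed, one_mul]

lemma integral_mul_norm_mollify_sq_le (ρ : ContDiffBump (0 : 𝔼)) {h : 𝔼 → F}
    (hh : LocallyIntegrable h volume) {w : 𝔼 → ℝ} (hw : Continuous w) (hw0 : ∀ x, 0 < w x)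
    {A R : ℝ} (hA : 0 ≤ A) (hR : ∀ y, R < ‖y‖ → h y = 0)
    (hwA : ∀ y t : 𝔼, ‖y‖ ≤ R → ‖t‖ ≤ ρ.rOut → w (y + t) ≤ A * w y)
    (hi : Integrable fun x => w x * ‖h x‖ ^ 2) :
    ∫ x, w x * ‖mollify ρ h x‖ ^ 2 ≤ A * ∫ x, w x * ‖h x‖ ^ 2 := by
  have hcm : Continuous (mollify ρ h) :=
    ρ.hasCompactSupport_normed.continuous_convolution_left _ ρ.continuous_normed hh
  have hof : ∀ (k : 𝔼 → F) (x : 𝔼), ENNReal.ofReal (w x * ‖k x‖ ^ 2)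
      = ENNReal.ofReal (w x) * ‖k x‖ₑ ^ 2 := fun k x => by
    rw [ENNReal.ofReal_mul (hw0 x).le, ENNReal.ofReal_pow (norm_nonneg _), ofReal_norm]
  have hn : ∀ (k : 𝔼 → F) (x : 𝔼), 0 ≤ w x * ‖k x‖ ^ 2 := fun k x =>
    mul_nonneg (hw0 x).le (by positivity)
  have hkey := lintegral_enorm_mollify_sq_le ρ hh.aestronglyMeasurable hw hA hR hwA
  simp_rw [← hof] at hkey
  rw [← ofReal_integral_eq_lintegral_ofReal hi (ae_of_all _ (hn h)), ← ENNReal.ofReal_mul hA]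
    at hkey
  rw [integral_eq_lintegral_of_nonneg_ae (ae_of_all _ (hn _))
    (hw.mul (hcm.norm.pow 2)).aestronglyMeasurable]
  refine ENNReal.toReal_le_of_le_ofReal ?_ hkey
  exact mul_nonneg hA (integral_nonneg (hn h))

/-- A positive continuous weight is almost constant, in ratio, at small scales on a ball. -/
lemma exists_weight_le {w : 𝔼 → ℝ} (hw : Continuous w) (hw0 : ∀ x, 0 < w x) (R : ℝ) {δ : ℝ}
    (hδ : 0 < δ) :
    ∃ ε > 0, ∀ y t : 𝔼, ‖y‖ ≤ R → ‖t‖ ≤ ε → w (y + t) ≤ (1 + δ) * w y := by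
  have hK := isCompact_closedBall (0 : 𝔼) R
  rcases lt_or_ge R 0 with hR | hR
  · exact ⟨1, one_pos, fun y t hy => absurd (hy.trans_lt hR) (not_lt.2 (norm_nonneg y))⟩
  obtain ⟨z, hz, hzmin⟩ := hK.exists_isMinOn ⟨0, by simpa using hR⟩ hw.continuousOn
  have huc := (isCompact_closedBall (0 : 𝔼) (R + 1)).uniformContinuousOn_of_continuous
    hw.continuousOn
  rw [Metric.uniformContinuousOn_iff] at huc
  obtain ⟨ε, hε, h⟩ := huc (δ * w z) (mul_pos hδ (hw0 z))
  refine ⟨min (ε / 2) 1, by positivity, fun y t hy ht => ?_⟩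
  have ht1 : ‖t‖ ≤ 1 := ht.trans (min_le_right _ _)
  have ht2 : ‖t‖ < ε := (ht.trans (min_le_left _ _)).trans_lt (by linarith)
  have h1 := h (y + t) (by
    rw [mem_closedBall_zero_iff]
    exact (norm_add_le _ _).trans (add_le_add hy ht1)) y (by
    rw [mem_closedBall_zero_iff]
    linarith) (by simpa [dist_eq_norm] using ht2)
  have h2 : w z ≤ w y := hzmin (by simpa using hy)
  rw [Real.dist_eq] at h1
  have h3 := (le_abs_self _).trans h1.le
  nlinarith

end Mollify

/-! ### Extension to weakly differentiable functions -/

lemma HasWeakGradient.isC1c_mollify {u : 𝔼 → ℝ} {G : 𝔼 → 𝔼} (hG : HasWeakGradient u G)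
    (hs : HasCompactSupport u) (ρ : ContDiffBump (0 : 𝔼)) : IsC1c (mollify ρ u) (mollify ρ G) := by
  set r := ρ.normed volume with hr
  have hrs : HasCompactSupport r := ρ.hasCompactSupport_normed
  have hrd : ContDiff ℝ ∞ r := ρ.contDiff_normed
  refine ⟨fun x => ?_,
    hrs.continuous_convolution_left _ hrd.continuous hG.locallyIntegrable_gradient,
    hrs.convolution _ hs⟩
  refine (hrs.hasFDerivAt_convolution_left (ContinuousLinearMap.lsmul ℝ ℝ)
    (hrd.of_le (by simp)) hG.locallyIntegrable x).congr_fderiv ?_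
  ext v
  have hint : Integrable (fun t => ((ContinuousLinearMap.lsmul ℝ ℝ : ℝ →L[ℝ] ℝ →L[ℝ] ℝ).precompL 𝔼)
      (fderiv ℝ r t) (u (x - t))) :=
    HasCompactSupport.convolutionExists_left _ (hrs.fderiv (𝕜 := ℝ))
      (hrd.continuous_fderiv (by simp)) hG.locallyIntegrable x
  have hφ : ContDiff ℝ ∞ fun t => r (x - t) := hrd.comp (contDiff_const.sub contDiff_id)
  have hφs : HasCompactSupport fun t => r (x - t) :=
    hrs.comp_homeomorph (Homeomorph.subLeft x)
  have hφd : ∀ t, fderiv ℝ (fun t => r (x - t)) t v = -fderiv ℝ r (x - t) v := by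
    intro t
    have h1 : HasFDerivAt (fun t : 𝔼 => x - t) (-ContinuousLinearMap.id ℝ 𝔼) t :=
      (hasFDerivAt_id t).const_sub x
    have h2 := ((hrd.differentiable (by simp)) (x - t)).hasFDerivAt.comp t h1
    have h3 : fderiv ℝ (fun t => r (x - t)) t = _ := h2.fderiv
    rw [h3]
    simp
  have hleft : (convolution (fderiv ℝ r) u
      ((ContinuousLinearMap.lsmul ℝ ℝ : ℝ →L[ℝ] ℝ →L[ℝ] ℝ).precompL 𝔼) volume x) v
        = ∫ t, fderiv ℝ r (x - t) v * u t := by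
    refine (ContinuousLinearMap.integral_apply hint v).trans ?_
    rw [← integral_sub_left_eq_self (fun t => fderiv ℝ r (x - t) v * u t) volume x]
    simp
  have hright : mollify ρ G x = ∫ t, r (x - t) • G t := by
    rw [← integral_sub_left_eq_self (fun t => r (x - t) • G t) volume x]
    simp only [sub_sub_cancel]
    rfl
  have hGi : Integrable fun t => r (x - t) • G t :=
    hG.locallyIntegrable_gradient.integrable_smul_left_of_hasCompactSupport hφ.continuous hφs
  have hweak := hG.integral_eq (fun t => r (x - t)) hφ hφs v
  simp_rw [hφd] at hweak
  rw [hleft, hright, innerSL_apply_apply, real_inner_comm]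
  have h4 : inner ℝ v (∫ t, r (x - t) • G t) = ∫ t, inner ℝ v (r (x - t) • G t) :=
    ((innerSL ℝ v).integral_comp_comm hGi).symm
  have h5 : ∀ t, inner ℝ v (r (x - t) • G t) = r (x - t) * inner ℝ (G t) v := fun t => by
    rw [inner_smul_right, real_inner_comm]
  simp_rw [h4, h5]
  simp_rw [mul_neg, integral_neg, neg_inj, mul_comm (u _)] at hweak
  exact hweak

/-- The logarithmic Sobolev inequality for weakly differentiable functions of bounded support. -/
theorem HasWeakGradient.satisfiesLSI_of_bounded_support {u : 𝔼 → ℝ} {G : 𝔼 → 𝔼}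
    (hG : HasWeakGradient u G) (hu2 : Integrable (fun x => u x ^ 2) (gaussian d))
    (hG2 : Integrable (fun x => ‖G x‖ ^ 2) (gaussian d)) {R : ℝ} (hRu : ∀ x, R < ‖x‖ → u x = 0)
    (hRG : ∀ x, R < ‖x‖ → G x = 0) {τ : ℝ} (hτ : 0 < τ) (hτ1 : τ ≤ 1) : SatisfiesLSI τ u G := by
  have hs : HasCompactSupport u :=
    HasCompactSupport.intro (isCompact_closedBall (0 : 𝔼) R) fun x hx => hRu x (by simpa using hx)
  let ρ : ℕ → ContDiffBump (0 : 𝔼) := fun n =>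
    ⟨1 / (2 * ((n : ℝ) + 1)), 1 / ((n : ℝ) + 1), by positivity,
      one_div_lt_one_div_of_lt (by positivity) (by
        have : (0 : ℝ) ≤ n := n.cast_nonneg
        linarith)⟩
  have hρ0 : Tendsto (fun n => (ρ n).rOut) atTop (𝓝 0) := tendsto_one_div_add_atTop_nhds_zero_nat
  have hρK : ∀ᶠ n in atTop, (ρ n).rOut ≤ 2 * (ρ n).rIn := Eventually.of_forall fun n => by
    simp only [ρ]
    rw [mul_one_div, div_mul_cancel_left₀ two_ne_zero, one_div]
  have hC : ∀ n, IsC1c (mollify (ρ n) u) (mollify (ρ n) G) := fun n => hG.isC1c_mollify hs (ρ n)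
  have hae : ∀ᵐ x ∂(gaussian d), Tendsto (fun n => mollify (ρ n) u x) atTop (𝓝 (u x)) :=
    gaussian_ac.ae_le (ContDiffBump.ae_convolution_tendsto_right_of_locallyIntegrable hρ0 hρK
      hG.locallyIntegrable)
  -- The quadratic functionals with a continuous positive weight do not increase in the limit.
  have hw : ∀ {F : Type} [NormedAddCommGroup F] [NormedSpace ℝ F] {h : 𝔼 → F} {p : 𝔼 → ℝ},
      LocallyIntegrable h volume → (∀ x, R < ‖x‖ → h x = 0) → Continuous p → (∀ x, 0 < p x) →
      Integrable (fun x => p x * ‖h x‖ ^ 2) (gaussian d) → ∀ c,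
      ∫ x, p x * ‖h x‖ ^ 2 ∂(gaussian d) < c →
      ∀ᶠ n in atTop, ∫ x, p x * ‖mollify (ρ n) h x‖ ^ 2 ∂(gaussian d) < c := by
    intro F _ _ h p hh hRh hp hp0 hi c hc
    have hw : Continuous fun x : 𝔼 => gaussianDensity d x * p x := continuous_gaussianDensity.mul hp
    have hw0 : ∀ x : 𝔼, 0 < gaussianDensity d x * p x := fun x =>
      mul_pos (gaussianDensity_pos x) (hp0 x)
    rw [integrable_gaussian_iff] at hi
    simp only [integral_gaussian, smul_eq_mul, ← mul_assoc] at hc hi ⊢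
    set J := ∫ x : 𝔼, gaussianDensity d x * p x * ‖h x‖ ^ 2
    have hJ : 0 ≤ J := integral_nonneg fun x => mul_nonneg (hw0 x).le (by positivity)
    obtain ⟨δ, hδ, hδc⟩ : ∃ δ > 0, (1 + δ) * J < c := by
      refine ⟨(c - J) / (2 * (J + 1)), div_pos (by linarith) (by positivity), ?_⟩
      have : (c - J) / (2 * (J + 1)) * J ≤ (c - J) / 2 := by
        rw [div_mul_eq_mul_div, div_le_div_iff₀ (by positivity) two_pos]
        nlinarith
      linarith
    obtain ⟨ε, hε, hwε⟩ := exists_weight_le hw hw0 R hδ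
    filter_upwards [hρ0.eventually_le_const hε] with n hn
    exact (integral_mul_norm_mollify_sq_le (ρ n) hh hw hw0 (by linarith) hRh
      (fun y t hy ht => hwε y t hy (ht.trans hn)) hi).trans_lt hδc
  have hmle : ∀ c, ∫ x, u x ^ 2 ∂(gaussian d) < c →
      ∀ᶠ n in atTop, ∫ x, mollify (ρ n) u x ^ 2 ∂(gaussian d) < c := by
    have := hw (p := fun _ => 1) hG.locallyIntegrable hRu continuous_const (fun _ => one_pos)
    simpa only [one_mul, Real.norm_eq_abs, sq_abs, hu2, true_imp_iff] using this
  have hIle : ∀ c, ∫ x, ‖G x‖ ^ 2 ∂(gaussian d) < c →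
      ∀ᶠ n in atTop, ∫ x, ‖mollify (ρ n) G x‖ ^ 2 ∂(gaussian d) < c := by
    have := hw (p := fun _ => 1) hG.locallyIntegrable_gradient hRG continuous_const
      (fun _ => one_pos)
    simpa only [one_mul, hG2, true_imp_iff] using this
  have hi2 : ∀ n, Integrable (fun x => mollify (ρ n) u x ^ 2) (gaussian d) := fun n => by
    simpa using (hC n).integrable_of_mul (F := fun _ => 1) continuous_const
  have hiM : ∀ n, Integrable (fun x => mollify (ρ n) u x ^ 2 * ‖x‖ ^ 2) (gaussian d) := fun n =>
    (hC n).integrable_of_mul (by fun_prop)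
  have hm := tendsto_integral_of_eventually_le hi2 (fun n x => sq_nonneg _)
    (fun x => sq_nonneg (u x)) hu2
    (by filter_upwards [hae] with x hx using hx.pow 2) hmle
  have hmeas : AEStronglyMeasurable u (gaussian d) :=
    hG.locallyIntegrable.aestronglyMeasurable.mono_ac gaussian_ac
  have hMi : Integrable (fun x => u x ^ 2 * ‖x‖ ^ 2) (gaussian d) := by
    refine (hu2.const_mul (R ^ 2)).mono' ?_ (ae_of_all _ fun x => ?_)
    · exact hu2.1.mul (by fun_prop : Continuous fun x : 𝔼 => ‖x‖ ^ 2).aestronglyMeasurable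
    · rw [Real.norm_of_nonneg (by positivity)]
      by_cases hx : R < ‖x‖
      · simp [hRu x hx]
      · rw [mul_comm]
        exact mul_le_mul_of_nonneg_right
          (pow_le_pow_left₀ (norm_nonneg _) (not_lt.1 hx) 2) (sq_nonneg _)
  -- The weight `‖x‖²` vanishes at the origin, so the second moment is controlled through the weight
  -- `1 + ‖x‖²` and the convergence of the mass.
  have hMle : ∀ c, ∫ x, u x ^ 2 * ‖x‖ ^ 2 ∂(gaussian d) < c →
      ∀ᶠ n in atTop, ∫ x, mollify (ρ n) u x ^ 2 * ‖x‖ ^ 2 ∂(gaussian d) < c := by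
    intro c hc
    have h1 := hw (p := fun x : 𝔼 => 1 + ‖x‖ ^ 2) hG.locallyIntegrable hRu (by fun_prop)
      (fun x => by positivity)
    simp only [Real.norm_eq_abs, sq_abs, add_mul, one_mul] at h1
    have hcomm : ∀ x : 𝔼, ‖x‖ ^ 2 * u x ^ 2 = u x ^ 2 * ‖x‖ ^ 2 := fun x => mul_comm _ _
    have hcomm' : ∀ n, ∀ x : 𝔼, ‖x‖ ^ 2 * mollify (ρ n) u x ^ 2 = mollify (ρ n) u x ^ 2 * ‖x‖ ^ 2 :=
      fun n x => mul_comm _ _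
    simp only [hcomm, hcomm'] at h1
    have h2 := h1 (hu2.add hMi)
    rw [integral_add hu2 hMi] at h2
    set m := ∫ x, u x ^ 2 ∂(gaussian d)
    set M := ∫ x, u x ^ 2 * ‖x‖ ^ 2 ∂(gaussian d)
    filter_upwards [h2 (m + M + (c - M) / 2) (by linarith),
      hm.eventually_const_lt (show m - (c - M) / 2 < m by linarith)] with n h3 h4
    rw [integral_add (hi2 n) (hiM n)] at h3
    linarith
  refine satisfiesLSI_of_tendsto hτ hτ1 (fun n => ⟨?_, (hC n).integral_sq_mul_log_le_lsiBound hτ⟩)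
    hmeas hae hm hMle hIle
  refine (Real.continuous_mul_log.comp
    ((hC n).continuous.pow 2)).integrable_of_hasCompactSupport ?_
  refine (hC n).hasCompactSupport.mono fun x hx h0 => hx ?_
  simp [show mollify (ρ n) u x = 0 from h0]

/-- Leibniz rule for the product with a smooth function. -/
lemma HasWeakGradient.mul_smooth {u : 𝔼 → ℝ} {G : 𝔼 → 𝔼} (hG : HasWeakGradient u G) {χ : 𝔼 → ℝ}
    {k : 𝔼 → 𝔼} (hχ : ContDiff ℝ ∞ χ) (hk : ∀ x, HasFDerivAt χ (innerSL ℝ (k x)) x)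
    (hkc : Continuous k) :
    HasWeakGradient (fun x => χ x * u x) (fun x => χ x • G x + u x • k x) := by
  refine ⟨hG.locallyIntegrable.continuous_smul hχ.continuous,
    (hG.locallyIntegrable_gradient.continuous_smul hχ.continuous).add
      (hG.locallyIntegrable.smul_continuous hkc), fun φ hφ hφs v => ?_⟩
  have hfd : ∀ x, fderiv ℝ (fun x => χ x * φ x) x v
      = χ x * fderiv ℝ φ x v + φ x * inner ℝ (k x) v := by
    intro x
    have h := (hk x).mul ((hφ.differentiable (by simp)) x).hasFDerivAt
    have h3 : fderiv ℝ (fun x => χ x * φ x) x = _ := h.fderiv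
    rw [h3]
    simp
  have hweak := hG.integral_eq (fun x => χ x * φ x) (hχ.mul hφ) hφs.mul_left v
  simp only [hfd] at hweak
  have hc1 : Continuous fun x => fderiv ℝ φ x v :=
    (hφ.continuous_fderiv (by simp)).clm_apply continuous_const
  have hs1 : HasCompactSupport fun x => fderiv ℝ φ x v := hφs.fderiv_apply (𝕜 := ℝ) v
  have hi1 : Integrable fun x => χ x * u x * fderiv ℝ φ x v := by
    refine (hG.locallyIntegrable.integrable_smul_left_of_hasCompactSupport
      (hχ.continuous.mul hc1) hs1.mul_left).congr (ae_of_all _ fun x => ?_)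
    simp only [smul_eq_mul, Pi.mul_apply]
    ring
  have hi2 : Integrable fun x => φ x * inner ℝ (u x • k x) v := by
    refine (hG.locallyIntegrable.integrable_smul_left_of_hasCompactSupport
      (hφ.continuous.mul (hkc.inner (continuous_const (y := v)))) hφs.mul_right).congr
      (ae_of_all _ fun x => ?_)
    simp only [smul_eq_mul, inner_smul_left]
    simp
    ring
  have hi3 : Integrable fun x => φ x * inner ℝ (χ x • G x) v := by
    refine ((hG.locallyIntegrable_gradient.integrable_smul_left_of_hasCompactSupport
      (hφ.continuous.mul hχ.continuous) hφs.mul_right).inner_const v).congr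
      (ae_of_all _ fun x => ?_)
    simp only [inner_smul_left]
    simp
    ring
  have e1 : ∫ x, u x * (χ x * fderiv ℝ φ x v + φ x * inner ℝ (k x) v)
      = (∫ x, χ x * u x * fderiv ℝ φ x v) + ∫ x, φ x * inner ℝ (u x • k x) v := by
    rw [← integral_add hi1 hi2]
    congr 1
    ext x
    simp only [inner_smul_left]
    simp
    ring
  have e2 : ∫ x, χ x * φ x * inner ℝ (G x) v = ∫ x, φ x * inner ℝ (χ x • G x) v := by
    congr 1
    ext x
    simp only [inner_smul_left]
    simp
    ring
  have e3 : ∫ x, φ x * inner ℝ (χ x • G x + u x • k x) v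
      = (∫ x, φ x * inner ℝ (χ x • G x) v) + ∫ x, φ x * inner ℝ (u x • k x) v := by
    rw [← integral_add hi3 hi2]
    congr 1
    ext x
    rw [inner_add_left, mul_add]
  rw [e1, e2] at hweak
  rw [e3]
  linarith

/-- The logarithmic Sobolev inequality on `H¹(γ)`, for functions with a finite second moment. -/
theorem HasWeakGradient.satisfiesLSI {u : 𝔼 → ℝ} {G : 𝔼 → 𝔼} (hG : HasWeakGradient u G)
    (hu2 : Integrable (fun x => u x ^ 2) (gaussian d))
    (hG2 : Integrable (fun x => ‖G x‖ ^ 2) (gaussian d))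
    (hM2 : Integrable (fun x => u x ^ 2 * ‖x‖ ^ 2) (gaussian d)) {τ : ℝ} (hτ : 0 < τ)
    (hτ1 : τ ≤ 1) : SatisfiesLSI τ u G := by
  let χ : ContDiffBump (0 : 𝔼) := ⟨1, 2, one_pos, one_lt_two⟩
  have hχd : ContDiff ℝ ∞ χ := χ.contDiff
  let k : 𝔼 → 𝔼 := fun x => gradient χ x
  have hk : ∀ x, HasFDerivAt χ (innerSL ℝ (k x)) x := fun x =>
    ((hχd.differentiable (by simp)) x).hasGradientAt.hasFDerivAt
  have hkc : Continuous k :=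
    (InnerProductSpace.toDual ℝ 𝔼).symm.continuous.comp (hχd.continuous_fderiv (by simp))
  obtain ⟨C, hC⟩ : ∃ C, ∀ x, ‖k x‖ ≤ C := by
    obtain ⟨C, hC⟩ := (χ.hasCompactSupport.fderiv (𝕜 := ℝ)).exists_bound_of_continuous
      (hχd.continuous_fderiv (by simp))
    refine ⟨C, fun x => ?_⟩
    rw [← innerSL_apply_norm (𝕜 := ℝ), ← (hk x).fderiv]
    exact hC x
  let s : ℕ → ℝ := fun n => 1 / ((n : ℝ) + 1)
  have hs0 : ∀ n, 0 < s n := fun n => by positivity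
  have hs1 : ∀ n, s n ≤ 1 := fun n => by
    rw [div_le_one (by positivity)]
    have : (0 : ℝ) ≤ n := n.cast_nonneg
    linarith
  have hs : Tendsto s atTop (𝓝 0) := tendsto_one_div_add_atTop_nhds_zero_nat
  have hsx : ∀ x : 𝔼, Tendsto (fun n => s n • x) atTop (𝓝 0) := fun x => by
    simpa using hs.smul_const x
  have hχx : ∀ x : 𝔼, Tendsto (fun n => χ (s n • x)) atTop (𝓝 1) := fun x => by
    have h1 := (χ.continuous.tendsto 0).comp (hsx x)
    rwa [χ.one_of_mem_closedBall (by simp [χ])] at h1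
  have hkx : ∀ x : 𝔼, Tendsto (fun n => s n • k (s n • x)) atTop (𝓝 0) := fun x => by
    have h1 := hs.smul ((hkc.tendsto 0).comp (hsx x))
    rwa [zero_smul] at h1
  let v : ℕ → 𝔼 → ℝ := fun n x => χ (s n • x) * u x
  let H : ℕ → 𝔼 → 𝔼 := fun n x => χ (s n • x) • G x + u x • (s n • k (s n • x))
  have hvH : ∀ n, HasWeakGradient (v n) (H n) := fun n => by
    refine hG.mul_smooth (hχd.comp (contDiff_const_smul (s n))) (fun x => ?_)
      ((hkc.comp (continuous_const_smul (s n))).const_smul (s n))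
    have h1 : HasFDerivAt (fun x : 𝔼 => s n • x) (s n • ContinuousLinearMap.id ℝ 𝔼) x :=
      (hasFDerivAt_id x).const_smul (s n)
    refine ((hk (s n • x)).comp x h1).congr_fderiv ?_
    ext w
    simp
  have hmeas : AEStronglyMeasurable u (gaussian d) :=
    hG.locallyIntegrable.aestronglyMeasurable.mono_ac gaussian_ac
  have hvm : ∀ n, AEStronglyMeasurable (fun x => v n x ^ 2) (gaussian d) := fun n =>
    (continuous_pow 2).comp_aestronglyMeasurable
      ((hvH n).locallyIntegrable.aestronglyMeasurable.mono_ac gaussian_ac)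
  have hHm : ∀ n, AEStronglyMeasurable (fun x => ‖H n x‖ ^ 2) (gaussian d) := fun n =>
    (continuous_norm.pow 2).comp_aestronglyMeasurable
      ((hvH n).locallyIntegrable_gradient.aestronglyMeasurable.mono_ac gaussian_ac)
  have hvb : ∀ n x, v n x ^ 2 ≤ u x ^ 2 := fun n x => by
    rw [mul_pow]
    exact mul_le_of_le_one_left (sq_nonneg _) (pow_le_one₀ χ.nonneg χ.le_one)
  have hHb : ∀ n x, ‖H n x‖ ^ 2 ≤ 2 * ‖G x‖ ^ 2 + 2 * C ^ 2 * u x ^ 2 := fun n x => by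
    have h1 : ‖χ (s n • x) • G x‖ ≤ ‖G x‖ := by
      rw [norm_smul, Real.norm_of_nonneg χ.nonneg]
      exact mul_le_of_le_one_left (norm_nonneg _) χ.le_one
    have h2 : ‖u x • (s n • k (s n • x))‖ ≤ |u x| * C := by
      rw [norm_smul, norm_smul, Real.norm_of_nonneg (hs0 n).le]
      refine mul_le_mul_of_nonneg_left ?_ (norm_nonneg _)
      exact (mul_le_of_le_one_left (norm_nonneg _) (hs1 n)).trans (hC _)
    have h3 : ‖H n x‖ ≤ ‖G x‖ + |u x| * C := (norm_add_le _ _).trans (add_le_add h1 h2)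
    have h4 := pow_le_pow_left₀ (norm_nonneg _) h3 2
    have h5 := sq_nonneg (‖G x‖ - |u x| * C)
    have h6 := sq_abs (u x)
    have h7 : (|u x| * C) ^ 2 = C ^ 2 * u x ^ 2 := by rw [mul_pow, h6, mul_comm]
    nlinarith
  have hvlim : ∀ x, Tendsto (fun n => v n x) atTop (𝓝 (u x)) := fun x => by
    simpa using (hχx x).mul_const (u x)
  have hHlim : ∀ x, Tendsto (fun n => H n x) atTop (𝓝 (G x)) := fun x => by
    simpa using ((hχx x).smul_const (G x)).add ((hkx x).const_smul (u x))
  have hm : Tendsto (fun n => ∫ x, v n x ^ 2 ∂(gaussian d)) atTop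
      (𝓝 (∫ x, u x ^ 2 ∂(gaussian d))) :=
    tendsto_integral_of_dominated_convergence _ hvm hu2
      (fun n => ae_of_all _ fun x => (Real.norm_of_nonneg (sq_nonneg _)).trans_le (hvb n x))
      (ae_of_all _ fun x => (hvlim x).pow 2)
  have hM : Tendsto (fun n => ∫ x, v n x ^ 2 * ‖x‖ ^ 2 ∂(gaussian d)) atTop
      (𝓝 (∫ x, u x ^ 2 * ‖x‖ ^ 2 ∂(gaussian d))) := by
    refine tendsto_integral_of_dominated_convergence _ (fun n => ?_) hM2
      (fun n => ae_of_all _ fun x => ?_) (ae_of_all _ fun x => ((hvlim x).pow 2).mul_const _)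
    · exact (hvm n).mul (by fun_prop : Continuous fun x : 𝔼 => ‖x‖ ^ 2).aestronglyMeasurable
    · rw [Real.norm_of_nonneg (by positivity)]
      exact mul_le_mul_of_nonneg_right (hvb n x) (by positivity)
  have hHint : Integrable (fun x => 2 * ‖G x‖ ^ 2 + 2 * C ^ 2 * u x ^ 2) (gaussian d) :=
    (hG2.const_mul 2).add (hu2.const_mul (2 * C ^ 2))
  have hI : Tendsto (fun n => ∫ x, ‖H n x‖ ^ 2 ∂(gaussian d)) atTop
      (𝓝 (∫ x, ‖G x‖ ^ 2 ∂(gaussian d))) :=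
    tendsto_integral_of_dominated_convergence _ hHm hHint
      (fun n => ae_of_all _ fun x => (Real.norm_of_nonneg (sq_nonneg _)).trans_le (hHb n x))
      (ae_of_all _ fun x => (hHlim x).norm.pow 2)
  refine satisfiesLSI_of_tendsto hτ hτ1 (v := v) (H := H) (fun n => ?_) hmeas
    (ae_of_all _ hvlim) hm (fun c hc => hM.eventually_lt_const hc)
    (fun c hc => hI.eventually_lt_const hc)
  have hfar : ∀ x : 𝔼, 2 / s n < ‖x‖ → 2 < ‖s n • x‖ := fun x hx => by
    rw [norm_smul, Real.norm_of_nonneg (hs0 n).le, mul_comm]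
    rwa [div_lt_iff₀ (hs0 n)] at hx
  have hχ0 : ∀ x : 𝔼, 2 / s n < ‖x‖ → χ (s n • x) = 0 := fun x hx =>
    χ.zero_of_le_dist (by simpa using (hfar x hx).le)
  have hk0 : ∀ x : 𝔼, 2 / s n < ‖x‖ → k (s n • x) = 0 := fun x hx => by
    have h1 : fderiv ℝ χ (s n • x) = 0 := by
      have h2 : s n • x ∉ tsupport (fderiv ℝ χ) := fun h => by
        have h3 := tsupport_fderiv_subset ℝ h
        rw [χ.tsupport_eq, mem_closedBall_zero_iff] at h3
        exact absurd h3 (not_le.2 (hfar x hx))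
      exact image_eq_zero_of_notMem_tsupport h2
    simp only [k, gradient, h1, map_zero]
  refine (hvH n).satisfiesLSI_of_bounded_support (R := 2 / s n) ?_ ?_ ?_ ?_ hτ hτ1
  · exact hu2.mono' (hvm n)
      (ae_of_all _ fun x => (Real.norm_of_nonneg (sq_nonneg _)).trans_le (hvb n x))
  · exact hHint.mono' (hHm n)
      (ae_of_all _ fun x => (Real.norm_of_nonneg (sq_nonneg _)).trans_le (hHb n x))
  · intro x hx
    simp [v, hχ0 x hx]
  · intro x hx
    simp [H, hχ0 x hx, hk0 x hx]

/-! ### Optimization of the parameter -/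

/-- Weak gradients are unique almost everywhere. -/
lemma HasWeakGradient.ae_eq {u : 𝔼 → ℝ} {G G' : 𝔼 → 𝔼} (h : HasWeakGradient u G)
    (h' : HasWeakGradient u G') : G =ᵐ[volume] G' := by
  refine ae_eq_of_integral_contDiff_smul_eq h.locallyIntegrable_gradient
    h'.locallyIntegrable_gradient fun φ hφ hφs => ?_
  have key : ∀ {K : 𝔼 → 𝔼}, HasWeakGradient u K → ∀ v : 𝔼,
      inner ℝ v (∫ x, φ x • K x) = -∫ x, u x * fderiv ℝ φ x v := by
    intro K hK v
    have h1 : inner ℝ v (∫ x, φ x • K x) = ∫ x, inner ℝ v (φ x • K x) :=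
      ((innerSL ℝ v).integral_comp_comm
        (hK.locallyIntegrable_gradient.integrable_smul_left_of_hasCompactSupport
          hφ.continuous hφs)).symm
    have h2 : ∀ x, inner ℝ v (φ x • K x) = φ x * inner ℝ (K x) v := fun x => by
      rw [inner_smul_right, real_inner_comm]
    rw [h1, hK.integral_eq φ hφ hφs v, neg_neg]
    simp_rw [h2]
  exact ext_inner_left ℝ fun v => (key h v).trans (key h' v).symm

lemma eLpNorm_two_sq {α F : Type*} [MeasurableSpace α] {μ : Measure α} [NormedAddCommGroup F]
    {f : α → F} (hf : MemLp f 2 μ) :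
    eLpNorm f 2 μ ^ 2 = ENNReal.ofReal (∫ x, ‖f x‖ ^ 2 ∂μ) := by
  have h := eLpNorm_nnreal_pow_eq_lintegral (μ := μ) (f := f) (p := 2) two_ne_zero
  simp only [NNReal.coe_ofNat, ENNReal.rpow_ofNat, ENNReal.coe_ofNat] at h
  rw [h, ofReal_integral_eq_lintegral_ofReal (hf.integrable_norm_pow two_ne_zero)
    (ae_of_all _ fun x => by positivity)]
  refine lintegral_congr fun x => ?_
  rw [ENNReal.ofReal_pow (norm_nonneg _), ofReal_norm]

/-- Optimizing the parameter `τ` in the logarithmic Sobolev inequality, under the normalization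
`∫ u² dγ = 1` and the moment bound `∫ ‖x‖² u² dγ ≤ d`. -/
lemma lsiBound_one_le (hd : 1 ≤ d) {M I : ℝ} (hM : M ≤ d) (hI : 0 ≤ I) :
    lsiBound d (1 / (1 + 4 / (d : ℝ) * I)) 1 M I
      ≤ d / 2 * Real.log (1 + 4 / (d : ℝ) * I) := by
  have hd0 : (0 : ℝ) < d := by exact_mod_cast hd
  have hs : 0 < 1 + 4 / (d : ℝ) * I := by positivity
  unfold lsiBound
  set τ := 1 / (1 + 4 / (d : ℝ) * I) with hτ
  have hτ1 : τ ≤ 1 := by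
    rw [hτ, div_le_one hs]
    have : 0 ≤ 4 / (d : ℝ) * I := by positivity
    linarith
  have hτI : 4 * τ * I = d * (1 - τ) := by
    rw [hτ]
    field_simp
    ring
  have hlog : Real.log τ = -Real.log (1 + 4 / (d : ℝ) * I) := by
    rw [hτ, one_div, Real.log_inv]
  rw [hlog, Real.log_one]
  nlinarith [mul_le_mul_of_nonneg_left hM (by linarith : 0 ≤ (1 - τ) / 2)]

/-- `ψ(I) = I - (d/4) L` with `L = log (1 + 4 I / d)`, and `exp L ≥ 1 + L + L² / 2`. -/
lemma sq_div_le_psi (hd : 1 ≤ d) {T I : ℝ} (hI : 0 ≤ I) (hT : 0 ≤ T)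
    (hTI : T ≤ d / 2 * Real.log (1 + 4 / (d : ℝ) * I)) :
    1 / (2 * (d : ℝ)) * T ^ 2 ≤ psi d I := by
  have hd0 : (0 : ℝ) < d := by exact_mod_cast hd
  have hs : 0 < 1 + 4 / (d : ℝ) * I := by positivity
  unfold psi
  set L := Real.log (1 + 4 / (d : ℝ) * I) with hL
  have hL0 : 0 ≤ L := Real.log_nonneg (by
    have : 0 ≤ 4 / (d : ℝ) * I := by positivity
    linarith)
  have h1 := Real.quadratic_le_exp_of_nonneg hL0
  rw [hL, Real.exp_log hs, ← hL] at h1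
  have h2 : d / 4 * (L + L ^ 2 / 2) ≤ I := by
    calc d / 4 * (L + L ^ 2 / 2) ≤ d / 4 * (4 / (d : ℝ) * I) :=
          mul_le_mul_of_nonneg_left (by linarith) (by positivity)
      _ = I := by field_simp
  have h3 : T ^ 2 ≤ (d / 2 * L) ^ 2 := pow_le_pow_left₀ hT hTI 2
  have h4 : 1 / (2 * (d : ℝ)) * T ^ 2 ≤ 1 / (2 * (d : ℝ)) * (d / 2 * L) ^ 2 :=
    mul_le_mul_of_nonneg_left h3 (by positivity)
  have h5 : 1 / (2 * (d : ℝ)) * (d / 2 * L) ^ 2 = d / 8 * L ^ 2 := by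
    field_simp
    ring
  nlinarith

end GaussianLSI

/-- `G` is the weak gradient `∇u`. The conclusion includes that the entropy integral converges,
and that the `ψ` estimate is the stronger of the two. -/
theorem proposition1 (d : ℕ) (hd : 1 ≤ d)
    (u : EuclideanSpace ℝ (Fin d) → ℝ)
    (G : EuclideanSpace ℝ (Fin d) → EuclideanSpace ℝ (Fin d))
    (hu : GaussianLSI.MemH1 u) (hG : GaussianLSI.HasWeakGradient u G)
    (hnorm : eLpNorm u 2 (GaussianLSI.gaussian d) = 1)
    (hmoment : eLpNorm (fun x => u x • x) 2 (GaussianLSI.gaussian d) ^ 2 ≤ (d : ENNReal)) :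
    Integrable (fun x => |u x| ^ 2 * Real.log (|u x| ^ 2)) (GaussianLSI.gaussian d) ∧
    GaussianLSI.normSq G - 1 / 2 * GaussianLSI.entropy u
      ≥ 1 / (2 * (d : ℝ)) * GaussianLSI.entropy u ^ 2 ∧
    GaussianLSI.normSq G - 1 / 2 * GaussianLSI.entropy u
      ≥ GaussianLSI.psi d (GaussianLSI.normSq G) ∧
    GaussianLSI.psi d (GaussianLSI.normSq G)
      ≥ 1 / (2 * (d : ℝ)) * GaussianLSI.entropy u ^ 2 := by
  open GaussianLSI in
  obtain ⟨hu2, G', hG', hG'2⟩ := hu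
  have hG2 : MemLp G 2 (gaussian d) := hG'2.ae_eq (gaussian_ac.ae_le (hG'.ae_eq hG))
  have hx2 : MemLp (fun x => u x • x) 2 (gaussian d) := by
    refine ⟨hu2.1.smul continuous_id.aestronglyMeasurable, ?_⟩
    by_contra h
    rw [not_lt, top_le_iff] at h
    simp [h] at hmoment
  have hiu : Integrable (fun x => u x ^ 2) (gaussian d) := hu2.integrable_sq
  have hiG : Integrable (fun x => ‖G x‖ ^ 2) (gaussian d) := hG2.integrable_norm_pow two_ne_zero
  have hpt : ∀ x, ‖u x • x‖ ^ 2 = u x ^ 2 * ‖x‖ ^ 2 := fun x => by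
    rw [norm_smul, mul_pow, Real.norm_eq_abs, sq_abs]
  have hix : Integrable (fun x => u x ^ 2 * ‖x‖ ^ 2) (gaussian d) := by
    simpa only [hpt] using hx2.integrable_norm_pow two_ne_zero
  have hm : ∫ x, u x ^ 2 ∂(gaussian d) = 1 := by
    have h := eLpNorm_two_sq hu2
    rw [hnorm, one_pow] at h
    simpa only [Real.norm_eq_abs, sq_abs] using ENNReal.ofReal_eq_one.1 h.symm
  have hM : ∫ x, u x ^ 2 * ‖x‖ ^ 2 ∂(gaussian d) ≤ d := by
    rw [eLpNorm_two_sq hx2, ← ENNReal.ofReal_natCast, ENNReal.ofReal_le_ofReal_iff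
      (Nat.cast_nonneg d)] at hmoment
    simpa only [hpt] using hmoment
  have hI : 0 ≤ normSq G := integral_nonneg fun x => by positivity
  have hs : 0 ≤ 4 / (d : ℝ) * normSq G := by positivity
  obtain ⟨hint, hle⟩ := hG.satisfiesLSI hiu hiG hix (τ := 1 / (1 + 4 / (d : ℝ) * normSq G))
    (by positivity) (by rw [div_le_one (by positivity)]; linarith)
  have hent : entropy u = ∫ x, u x ^ 2 * Real.log (u x ^ 2) ∂(gaussian d) := by
    simp only [entropy, sq_abs]
  rw [hm, ← hent] at hle
  have hT := hle.trans (lsiBound_one_le hd hM hI)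
  -- The entropy is nonnegative because `t log t ≥ t - 1` and `∫ (u² - 1) = 0`.
  have hT0 : 0 ≤ entropy u := by
    have h1 : ∫ x, (u x ^ 2 - 1) ∂(gaussian d) = 0 := by
      rw [integral_sub hiu (integrable_const _), hm]
      simp
    rw [hent, ← h1]
    refine integral_mono (hiu.sub (integrable_const _)) hint fun x => ?_
    exact sub_one_le_mul_log (sq_nonneg _)
  have hthird := sq_div_le_psi hd hI hT0 hT
  have hsecond : psi d (normSq G) ≤ normSq G - 1 / 2 * entropy u := by
    unfold psi
    linarith
  exact ⟨by simpa only [sq_abs] using hint, hthird.trans hsecond, hsecond, hthird⟩
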